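/- Let $R$ be an associative ring with unity and let $\mathcal C$ be an $R$-coring: an $R$-bimodule with $R$-bilinear, coassociative comultiplication $\Delta:\mathcal C\to\mathcal C\otimes_R\mathcal C$, $\Delta(c)=\sum c_1\otimes c_2$, and $R$-bilinear counit $\varepsilon$. For a left $R$-module $W$ put ${}^*W=\mathrm{Hom}_{R-}(W,R)$, a right $R$-module by $(fr)(w)=f(w)r$, with the finite topology, i.e. the topology induced from the product topology on $R^W$ with $R$ discrete. The left dual ${}^*\mathcal C$ is a ring with product $(f\star g)(c)=\sum g(c_1f(c_2))$ and unit $\varepsilon$, and an $R$-ring by $(fr)(c)=f(c)r$, $(rf)(c)=f(cr)$. Let $\mathcal A$ be an $R$-ring with unity and let $\kappa:\mathcal A\to{}^*\mathcal C$ be a morphism of $R$-rings (that is, an $R$-bilinear unital ring homomorphism); write $\langle a,c\rangle=\kappa(a)(c)$. Thus $P=(\mathcal A,\mathcal C)$ is a measuring left $R$-pairing, and so is $({}^*\mathcal C,\mathcal C)$, with $\kappa=\mathrm{id}$. A right $\mathcal A$-module is a right $R$-module $M$ with an additive map $\rho_M:M\to\mathrm{Hom}_{-R}(\mathcal A,M)$,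 $\rho_M(m)(a)=ma$, such that $(mr)a=m(ra)$ and $m(ab)=(ma)b$; it is unital if $M\mathcal A=M$ and $\mathcal A$-faithful if $\rho_M$ is injective. Let $\mathcal M_{\mathcal A}$ and $\widetilde{\mathcal M}_{\mathcal A}$ be the categories of unital, respectively $\mathcal A$-faithful, right $\mathcal A$-modules with $R$-linear, $\mathcal A$-linear maps. Let $\mathcal M^{\mathcal C}$ be the category of right $\mathcal C$-comodules $(M,\varrho_M)$ with injective coaction (equivalently, counital comodules), with colinear maps. Every $M\in\mathcal M^{\mathcal C}$, in particular $\mathcal C$ itself, is a right $\mathcal A$-module by $ma=\sum m_{0}\langle a,m_{1}\rangle$, where $\varrho_M(m)=\sum m_0\otimes m_1$; this gives a functor from $\mathcal M^{\mathcal C}$ to right $\mathcal A$-modules that is the identity on underlying maps, and likewise a functor to right ${}^*\mathcal C$-modules. We call both *the canonical functors*. Let $\sigma[\mathcal C_{\mathcal A}]$ be the full subcategory of $\mathcal M_{\mathcal A}$ of all modules isomorphic to a submodule of a $\mathcal C$-generated module, i.e. of a quotient of a direct sum $\mathcal C^{(\Lambda)}$. For a right $\mathcal A$-module $M$ let $\mathrm{Rat}^{\mathcal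 C}(M_{\mathcal A})$ be the set of all $m\in M$ for which there is $\sum_i m_i\otimes c_i\in M\otimes_R\mathcal C$ with $ma=\sum_i m_i\langle a,c_i\rangle$ for all $a\in\mathcal A$, and call $M$ $\mathcal C$-rational if $\mathrm{Rat}^{\mathcal C}(M_{\mathcal A})=M$; $\mathrm{Rat}^{\mathcal C}(\mathcal M_{\mathcal A})$ and $\mathrm{Rat}^{\mathcal C}(\widetilde{\mathcal M}_{\mathcal A})$ denote the full subcategories of $\mathcal C$-rational modules that are unital, respectively $\mathcal A$-faithful. The same notation is used for ${}^*\mathcal C$ in place of $\mathcal A$. For a right $R$-module $V$, a left $R$-module $W$ and a right $R$-linear map $\kappa:V\to{}^*W$, write $\langle v,w\rangle=\kappa(v)(w)$. The pairing $(V,W)$ satisfies the left $\alpha$-condition if for every right $R$-module $M$ the map $M\otimes_RW\to\mathrm{Hom}_{-R}(V,M)$, $\sum m_i\otimes w_i\mapsto[v\mapsto\sum m_i\langle v,w_i\rangle]$, is injective; ${}_RW$ satisfies the $\alpha$-condition if $({}^*W,W)$ does. ${}_RW$ is locally projective if for every surjective $R$-linear $\pi:L\to N$, every $R$-linear $g:W\to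 N$ and every finitely generated submodule $F\subseteq W$ there is an $R$-linear $g':W\to L$ with $\pi g'|_F=g|_F$. **Theorem.** The following are equivalent: 1. ${}_R\mathcal C$ is locally projective and $\kappa(\mathcal A)\subseteq{}^*\mathcal C$ is dense; 2. ${}_R\mathcal C$ satisfies the $\alpha$-condition and $\kappa(\mathcal A)\subseteq{}^*\mathcal C$ is dense; 3. $(\mathcal A,\mathcal C)$ satisfies the left $\alpha$-condition; 4. $\sigma[\mathcal C_{{}^*\mathcal C}]\simeq\mathcal M^{\mathcal C}\simeq\sigma[\mathcal C_{\mathcal A}]$, meaning that the canonical functors are isomorphisms of categories from $\mathcal M^{\mathcal C}$ onto $\sigma[\mathcal C_{{}^*\mathcal C}]$ and onto $\sigma[\mathcal C_{\mathcal A}]$. If these conditions hold, then the canonical functors are isomorphisms of categories $$\mathcal M^{\mathcal C}\simeq\mathrm{Rat}^{\mathcal C}(\widetilde{\mathcal M}_{\mathcal A})=\mathrm{Rat}^{\mathcal C}(\mathcal M_{\mathcal A})=\sigma[\mathcal C_{\mathcal A}],\qquad \mathcal M^{\mathcal C}\simeq\mathrm{Rat}^{\mathcal C}(\widetilde{\mathcal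 M}_{{}^*\mathcal C})=\mathrm{Rat}^{\mathcal C}(\mathcal M_{{}^*\mathcal C})=\sigma[\mathcal C_{{}^*\mathcal C}],$$ and hence all these categories are isomorphic. -/

import Mathlib

open CategoryTheory MulOpposite
open scoped TensorProduct

universe u

noncomputable section

namespace Corings

/-! Right `R`-modules are modules over `Rᵐᵒᵖ`: `op r • m` is `m r`. -/

section Tensor

/-! ### Tensor products over a noncommutative ring -/

variable (R : Type u) [Ring R]

/-- The subgroup of `M ⊗_ℤ N` generated by the elements `m r ⊗ n - m ⊗ r n`. -/
def balancedSubgroup (M N : Type u) [AddCommGroup M] [Module Rᵐᵒᵖ M] [AddCommGroup N]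
    [Module R N] : AddSubgroup (M ⊗[ℤ] N) :=
  AddSubgroup.closure
    {x | ∃ (m : M) (r : R) (n : N), x = (op r • m) ⊗ₜ[ℤ] n - m ⊗ₜ[ℤ] (r • n)}

/-- The tensor product `M ⊗_R N` of a right `R`-module `M` and a left `R`-module `N`. -/
def BTensor (M N : Type u) [AddCommGroup M] [Module Rᵐᵒᵖ M] [AddCommGroup N]
    [Module R N] : Type u :=
  (M ⊗[ℤ] N) ⧸ balancedSubgroup R M N

namespace BTensor

variable {M N M' N' Q : Type u} [AddCommGroup M] [Module Rᵐᵒᵖ M] [AddCommGroup N] [Module R N]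
  [AddCommGroup M'] [Module Rᵐᵒᵖ M'] [AddCommGroup N'] [Module R N'] [AddCommGroup Q]

instance : AddCommGroup (BTensor R M N) :=
  inferInstanceAs (AddCommGroup ((M ⊗[ℤ] N) ⧸ balancedSubgroup R M N))

/-- The quotient map `M ⊗_ℤ N → M ⊗_R N`. -/
def proj : M ⊗[ℤ] N →+ BTensor R M N :=
  QuotientAddGroup.mk' (balancedSubgroup R M N)

lemma proj_surjective : Function.Surjective (proj R (M := M) (N := N)) :=
  QuotientAddGroup.mk'_surjective _

/-- The pure tensor `m ⊗ n`. -/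
def tmul (m : M) (n : N) : BTensor R M N :=
  proj R (m ⊗ₜ[ℤ] n)

variable {R}

lemma add_tmul (m m' : M) (n : N) : tmul R (m + m') n = tmul R m n + tmul R m' n := by
  rw [tmul, TensorProduct.add_tmul, map_add]; rfl

lemma tmul_add (m : M) (n n' : N) : tmul R m (n + n') = tmul R m n + tmul R m n' := by
  rw [tmul, TensorProduct.tmul_add, map_add]; rfl

lemma smul_tmul (m : M) (r : R) (n : N) : tmul R (op r • m) n = tmul R m (r • n) := by
  have h : (op r • m) ⊗ₜ[ℤ] n - m ⊗ₜ[ℤ] (r • n) ∈ (proj R (M := M) (N := N)).ker := by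
    exact (QuotientAddGroup.eq_zero_iff _).2 (AddSubgroup.subset_closure ⟨m, r, n, rfl⟩)
  rw [AddMonoidHom.mem_ker, map_sub, sub_eq_zero] at h
  exact h

/-- The universal property: a balanced biadditive map induces an additive map on `M ⊗_R N`. -/
def lift (f : M →+ N →+ Q) (hf : ∀ m (r : R) n, f (op r • m) n = f m (r • n)) :
    BTensor R M N →+ Q :=
  QuotientAddGroup.lift (balancedSubgroup R M N)
    (TensorProduct.liftAddHom f (fun z m n => by simp)) (by
      refine (AddSubgroup.closure_le
        (K := (TensorProduct.liftAddHom f (fun z m n => by simp)).ker)).2 ?_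
      rintro _ ⟨m, r, n, rfl⟩
      simp [AddMonoidHom.mem_ker, hf])

@[simp] lemma lift_tmul (f : M →+ N →+ Q) (hf : ∀ m (r : R) n, f (op r • m) n = f m (r • n))
    (m : M) (n : N) : lift f hf (tmul R m n) = f m n :=
  rfl

@[elab_as_elim]
lemma induction_on {p : BTensor R M N → Prop} (t : BTensor R M N) (zero : p 0)
    (tmul : ∀ m n, p (tmul R m n)) (add : ∀ s t, p s → p t → p (s + t)) : p t := by
  obtain ⟨t, rfl⟩ := proj_surjective R t
  induction t using TensorProduct.induction_on with
  | zero => exact zero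
  | tmul m n => exact tmul m n
  | add s t hs ht => exact add _ _ hs ht

lemma addHom_ext {f g : BTensor R M N →+ Q} (h : ∀ m n, f (tmul R m n) = g (tmul R m n)) :
    f = g := by
  ext t
  induction t using induction_on with
  | zero => simp
  | tmul m n => exact h m n
  | add s t hs ht => simp [hs, ht]

/-- The biadditive map `(m, n) ↦ m ⊗ n`. -/
def mkHom : M →+ N →+ BTensor R M N :=
  AddMonoidHom.mk' (fun m => AddMonoidHom.mk' (fun n => tmul R m n) (tmul_add m))
    (fun m m' => by ext n; exact add_tmul m m' n)

@[simp] lemma mkHom_apply (m : M) (n : N) : mkHom (R := R) m n = tmul R m n := rfl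

@[simp] lemma zero_tmul (n : N) : tmul R (0 : M) n = 0 := by
  rw [← mkHom_apply, map_zero]; rfl

@[simp] lemma tmul_zero (m : M) : tmul R m (0 : N) = 0 := by
  rw [← mkHom_apply, map_zero]

/-- The map `f ⊗ g : M ⊗_R N → M' ⊗_R N'`. -/
def map (f : M →ₗ[Rᵐᵒᵖ] M') (g : N →ₗ[R] N') : BTensor R M N →+ BTensor R M' N' :=
  lift ((AddMonoidHom.compl₂ mkHom g.toAddMonoidHom).comp f.toAddMonoidHom)
    (fun m r n => by simp [smul_tmul])

@[simp] lemma map_tmul (f : M →ₗ[Rᵐᵒᵖ] M') (g : N →ₗ[R] N') (m : M) (n : N) :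
    map f g (tmul R m n) = tmul R (f m) (g n) :=
  rfl

lemma map_id_id (t : BTensor R M N) :
    map (LinearMap.id : M →ₗ[Rᵐᵒᵖ] M) (LinearMap.id : N →ₗ[R] N) t = t := by
  induction t using induction_on with
  | zero => simp
  | tmul m n => simp
  | add s t hs ht => rw [map_add, hs, ht]

section RightModule

variable [Module Rᵐᵒᵖ N] [SMulCommClass R Rᵐᵒᵖ N]

/-- If `N` is an `R`-bimodule, then `M ⊗_R N` is a right `R`-module by `(m ⊗ n) r = m ⊗ n r`. -/
instance rightModule : Module Rᵐᵒᵖ (BTensor R M N) where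
  smul r := map LinearMap.id
    { toFun := fun n => r • n
      map_add' := smul_add r
      map_smul' := fun s n => (smul_comm s r n).symm }
  smul_zero r := map_zero (map LinearMap.id _)
  smul_add r := map_add (map LinearMap.id _)
  one_smul := DFunLike.congr_fun (f := map LinearMap.id _) (g := AddMonoidHom.id _)
    (addHom_ext fun m n => by simp)
  mul_smul r s := DFunLike.congr_fun (f := map LinearMap.id _)
    (g := (map LinearMap.id _).comp (map LinearMap.id _))
    (addHom_ext fun m n => by simp [mul_smul])
  add_smul r s := DFunLike.congr_fun (f := map LinearMap.id _)
    (g := (map LinearMap.id _) + (map LinearMap.id _))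
    (addHom_ext fun m n => by simp [add_smul, tmul_add])
  zero_smul := DFunLike.congr_fun (f := map LinearMap.id _) (g := 0)
    (addHom_ext fun m n => by simp)

lemma op_smul_tmul (r : Rᵐᵒᵖ) (m : M) (n : N) : r • tmul R m n = tmul R m (r • n) := rfl

end RightModule

section LeftModule

variable [Module R M] [SMulCommClass R Rᵐᵒᵖ M]

/-- If `M` is an `R`-bimodule, then `M ⊗_R N` is a left `R`-module by `r (m ⊗ n) = r m ⊗ n`. -/
instance leftModule : Module R (BTensor R M N) where
  smul r := map
    { toFun := fun m => r • m
      map_add' := smul_add r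
      map_smul' := fun s m => smul_comm r s m } LinearMap.id
  smul_zero r := map_zero (map _ LinearMap.id)
  smul_add r := map_add (map _ LinearMap.id)
  one_smul := DFunLike.congr_fun (f := map _ LinearMap.id) (g := AddMonoidHom.id _)
    (addHom_ext fun m n => by simp)
  mul_smul r s := DFunLike.congr_fun (f := map _ LinearMap.id)
    (g := (map _ LinearMap.id).comp (map _ LinearMap.id))
    (addHom_ext fun m n => by simp [mul_smul])
  add_smul r s := DFunLike.congr_fun (f := map _ LinearMap.id)
    (g := (map _ LinearMap.id) + (map _ LinearMap.id))
    (addHom_ext fun m n => by simp [add_smul, add_tmul])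
  zero_smul := DFunLike.congr_fun (f := map _ LinearMap.id) (g := 0)
    (addHom_ext fun m n => by simp)

lemma smul_tmul' (r : R) (m : M) (n : N) : r • tmul R m n = tmul R (r • m) n := rfl

end LeftModule

instance [Module R M] [SMulCommClass R Rᵐᵒᵖ M] [Module Rᵐᵒᵖ N] [SMulCommClass R Rᵐᵒᵖ N] :
    SMulCommClass R Rᵐᵒᵖ (BTensor R M N) where
  smul_comm r s t := by
    induction t using induction_on with
    | zero => simp
    | tmul m n => simp [op_smul_tmul, smul_tmul']
    | add t t' h h' => simp [h, h']

section Assoc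

variable {L : Type u} [Module Rᵐᵒᵖ N] [SMulCommClass R Rᵐᵒᵖ N] [AddCommGroup L] [Module R L]

/-- Auxiliary map: `m ⊗ n ↦ (l ↦ m ⊗ (n ⊗ l))`. -/
def assocAux : BTensor R M N →+ L →+ BTensor R M (BTensor R N L) :=
  lift
    (AddMonoidHom.mk' (fun m => AddMonoidHom.mk' (fun n => (mkHom m).comp (mkHom n))
      (fun n n' => by ext l; simp [tmul_add]))
      (fun m m' => by ext n l; simp))
    (fun m r n => by ext l; simp [smul_tmul, smul_tmul'])

@[simp] lemma assocAux_tmul (m : M) (n : N) (l : L) :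
    assocAux (tmul R m n) l = tmul R m (tmul R n l) :=
  rfl

lemma assocAux_balanced (t : BTensor R M N) (r : R) (l : L) :
    assocAux (op r • t) l = assocAux t (r • l) := by
  induction t using induction_on with
  | zero => rw [smul_zero, map_zero]; rfl
  | tmul m n => rw [op_smul_tmul, assocAux_tmul, assocAux_tmul, smul_tmul]
  | add t t' h h' =>
    rw [smul_add, map_add, map_add, AddMonoidHom.add_apply, AddMonoidHom.add_apply, h, h']

variable (M N L) in
/-- The associativity map `(M ⊗_R N) ⊗_R L → M ⊗_R (N ⊗_R L)`. -/
def assoc : BTensor R (BTensor R M N) L →+ BTensor R M (BTensor R N L) :=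
  lift assocAux assocAux_balanced

@[simp] lemma assoc_tmul (m : M) (n : N) (l : L) :
    assoc M N L (tmul R (tmul R m n) l) = tmul R m (tmul R n l) :=
  rfl

end Assoc

/-- The canonical map `M ⊗_R R → M`, `m ⊗ r ↦ m r`. -/
def rid (M : Type u) [AddCommGroup M] [Module Rᵐᵒᵖ M] : BTensor R M R →+ M :=
  lift (AddMonoidHom.mk' (fun m => AddMonoidHom.mk' (fun r => op r • m)
      (fun r s => by simp [add_smul])) (fun m m' => by ext r; simp))
    (fun m r s => by simp [mul_smul])

/-- The canonical map `R ⊗_R N → N`, `r ⊗ n ↦ r n`. -/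
def lid (N : Type u) [AddCommGroup N] [Module R N] : BTensor R R N →+ N :=
  lift (AddMonoidHom.mk' (fun r => AddMonoidHom.mk' (fun n => r • n)
      (fun n n' => by simp)) (fun r s => by ext n; simp [add_smul]))
    (fun r s n => by simp [mul_smul])

@[simp] lemma rid_tmul (m : M) (r : R) : rid M (tmul R m r) = op r • m := rfl

@[simp] lemma lid_tmul (r : R) (n : N) : lid N (tmul R r n) = r • n := rfl

end BTensor

end Tensor

section Corings

/-! ### Corings and their left dual rings -/

variable (R : Type u) [Ring R]

/-- `R`-bilinear maps between `R`-bimodules. -/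
structure BilinHom (M N : Type u) [AddCommGroup M] [Module R M] [Module Rᵐᵒᵖ M]
    [AddCommGroup N] [Module R N] [Module Rᵐᵒᵖ N] extends M →ₗ[R] N where
  map_op_smul' : ∀ (r : R) (m : M), toFun (op r • m) = op r • toFun m

/-- The underlying map of right `R`-modules. -/
def BilinHom.right {R : Type u} [Ring R] {M N : Type u} [AddCommGroup M] [Module R M]
    [Module Rᵐᵒᵖ M] [AddCommGroup N] [Module R N] [Module Rᵐᵒᵖ N] (f : BilinHom R M N) :
    M →ₗ[Rᵐᵒᵖ] N where
  toFun := f.toLinearMap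
  map_add' := map_add f.toLinearMap
  map_smul' r m := f.map_op_smul' r.unop m

@[simp] lemma BilinHom.right_apply {R : Type u} [Ring R] {M N : Type u} [AddCommGroup M]
    [Module R M] [Module Rᵐᵒᵖ M] [AddCommGroup N] [Module R N] [Module Rᵐᵒᵖ N]
    (f : BilinHom R M N) (m : M) : f.right m = f.toLinearMap m := rfl

/-- A coassociative counital `R`-coring structure on an `R`-bimodule `C`. -/
class Coring (C : Type u) [AddCommGroup C] [Module R C] [Module Rᵐᵒᵖ C]
    [SMulCommClass R Rᵐᵒᵖ C] where
  /-- comultiplication -/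
  comul : BilinHom R C (BTensor R C C)
  /-- counit -/
  counit : BilinHom R C R
  coassoc : ∀ c : C,
    BTensor.assoc C C C (BTensor.map comul.right LinearMap.id (comul.toLinearMap c)) =
      BTensor.map LinearMap.id comul.toLinearMap (comul.toLinearMap c)
  counit_left : ∀ c : C,
    BTensor.lid C (BTensor.map counit.right LinearMap.id (comul.toLinearMap c)) = c
  counit_right : ∀ c : C,
    BTensor.rid C (BTensor.map LinearMap.id counit.toLinearMap (comul.toLinearMap c)) = c

/-- The left dual `*W = Hom_{R-}(W, R)` of a left `R`-module `W`. -/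
def LeftDual (W : Type u) [AddCommGroup W] [Module R W] : Type u := W →ₗ[R] R

namespace LeftDual

section Module

variable {R} {W : Type u} [AddCommGroup W] [Module R W]

instance : AddCommGroup (LeftDual R W) := inferInstanceAs (AddCommGroup (W →ₗ[R] R))

instance : FunLike (LeftDual R W) W R := inferInstanceAs (FunLike (W →ₗ[R] R) W R)

instance : LinearMapClass (LeftDual R W) R W R :=
  inferInstanceAs (LinearMapClass (W →ₗ[R] R) R W R)

/-- The right `R`-module structure `(f r)(w) = f(w) r`. -/
instance : Module Rᵐᵒᵖ (LeftDual R W) := inferInstanceAs (Module Rᵐᵒᵖ (W →ₗ[R] R))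

@[ext] lemma ext {f g : LeftDual R W} (h : ∀ w, f w = g w) : f = g := DFunLike.ext _ _ h

@[simp] lemma add_apply (f g : LeftDual R W) (w : W) : (f + g) w = f w + g w := rfl

@[simp] lemma zero_apply (w : W) : (0 : LeftDual R W) w = 0 := rfl

@[simp] lemma op_smul_apply (r : R) (f : LeftDual R W) (w : W) : (op r • f) w = f w * r := rfl

variable [Module Rᵐᵒᵖ W] [SMulCommClass R Rᵐᵒᵖ W]

/-- For an `R`-bimodule `W`, the left `R`-module structure `(r f)(w) = f(w r)`. -/
instance : Module R (LeftDual R W) where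
  smul r f :=
    { toFun := fun w => f (op r • w)
      map_add' := fun w w' => by rw [smul_add, map_add]
      map_smul' := fun s w => by rw [← smul_comm s (op r) w, map_smul]; rfl }
  one_smul f := by ext w; change f (op 1 • w) = f w; simp
  mul_smul r s f := by
    ext w; change f (op (r * s) • w) = f (op s • op r • w); rw [MulOpposite.op_mul, mul_smul]
  smul_zero r := rfl
  smul_add r f g := rfl
  add_smul r s f := by
    ext w; change f (op (r + s) • w) = f (op r • w) + f (op s • w); rw [MulOpposite.op_add, add_smul, map_add]
  zero_smul f := by ext w; change f (op 0 • w) = 0; simp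

@[simp] lemma smul_apply (r : R) (f : LeftDual R W) (w : W) : (r • f) w = f (op r • w) := rfl

instance : SMulCommClass R Rᵐᵒᵖ (LeftDual R W) where
  smul_comm _ _ _ := rfl

end Module

variable {R} {M M' W : Type u} [AddCommGroup M] [Module Rᵐᵒᵖ M] [AddCommGroup M']
  [Module Rᵐᵒᵖ M'] [AddCommGroup W] [Module R W]

/-- The map `M ⊗_R W → M`, `m ⊗ w ↦ m f(w)`, attached to `f ∈ *W`. -/
def contract (f : LeftDual R W) : BTensor R M W →+ M :=
  BTensor.lift (AddMonoidHom.mk' (fun m => AddMonoidHom.mk' (fun w => op (f w) • m)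
      (fun w w' => by simp [add_smul])) (fun m m' => by ext w; simp))
    (fun m r w => by simp [mul_smul])

@[simp] lemma contract_tmul (f : LeftDual R W) (m : M) (w : W) :
    contract f (BTensor.tmul R m w) = op (f w) • m := rfl

lemma contract_add (f g : LeftDual R W) (t : BTensor R M W) :
    contract (f + g) t = contract f t + contract g t := by
  induction t using BTensor.induction_on with
  | zero => simp
  | tmul m w => simp [add_smul]
  | add s t hs ht => simp only [map_add, hs, ht]; abel

lemma contract_op_smul (r : R) (f : LeftDual R W) (t : BTensor R M W) :
    contract (op r • f) t = op r • contract f t := by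
  induction t using BTensor.induction_on with
  | zero => simp
  | tmul m w => simp [mul_smul]
  | add s t hs ht => simp [hs, ht]

lemma contract_smul [Module Rᵐᵒᵖ W] [SMulCommClass R Rᵐᵒᵖ W] (r : R) (f : LeftDual R W)
    (t : BTensor R M W) : contract (r • f) t = contract f (op r • t) := by
  induction t using BTensor.induction_on with
  | zero => simp
  | tmul m w => simp [BTensor.op_smul_tmul]
  | add s t hs ht => simp [hs, ht]

lemma contract_map (f : LeftDual R W) (h : M →ₗ[Rᵐᵒᵖ] M') (t : BTensor R M W) :
    contract f (BTensor.map h LinearMap.id t) = h (contract f t) := by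
  induction t using BTensor.induction_on with
  | zero => simp
  | tmul m w => simp
  | add s t hs ht => simp [hs, ht]

/-- If `M` is an `R`-bimodule, then `m ⊗ w ↦ m f(w)` is left `R`-linear. -/
def contractLeft [Module R M] [SMulCommClass R Rᵐᵒᵖ M] (f : LeftDual R W) :
    BTensor R M W →ₗ[R] M where
  toFun := contract f
  map_add' := map_add _
  map_smul' r t := by
    induction t using BTensor.induction_on with
    | zero => simp
    | tmul m w => simp [BTensor.smul_tmul', smul_comm]
    | add s t hs ht => simp_all

variable {C : Type u} [AddCommGroup C] [Module R C] [Module Rᵐᵒᵖ C] [SMulCommClass R Rᵐᵒᵖ C]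
  [Coring R C]

/-- The left `R`-linear map `C → C`, `c ↦ ∑ c₁ f(c₂)`, attached to `f ∈ *C`. -/
def translate (f : LeftDual R C) : C →ₗ[R] C :=
  (contractLeft f).comp (Coring.comul (R := R) (C := C)).toLinearMap

lemma translate_apply (f : LeftDual R C) (c : C) :
    translate f c = contract f ((Coring.comul (R := R)).toLinearMap c) := rfl

/-- The product of the left dual ring: `(f ⋆ g)(c) = ∑ g(c₁ f(c₂))`. -/
instance : Mul (LeftDual R C) where
  mul f g := (show C →ₗ[R] R from g).comp (translate f)

/-- The counit is the unit of the left dual ring. -/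
instance : One (LeftDual R C) where
  one := (Coring.counit (R := R) (C := C)).toLinearMap

lemma mul_apply (f g : LeftDual R C) (c : C) : (f * g) c = g (translate f c) := rfl

lemma one_apply (c : C) : (1 : LeftDual R C) c = (Coring.counit (R := R)).toLinearMap c := rfl

lemma contract_one (t : BTensor R M C) :
    contract (1 : LeftDual R C) t =
      BTensor.rid M (BTensor.map LinearMap.id (Coring.counit (R := R)).toLinearMap t) := by
  induction t using BTensor.induction_on with
  | zero => simp
  | tmul m c => simp [one_apply]
  | add s t hs ht => simp [hs, ht]

lemma contract_map_translate (f g : LeftDual R C) (t : BTensor R M C) :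
    contract g (BTensor.map LinearMap.id (translate f) t) = contract (f * g) t := by
  induction t using BTensor.induction_on with
  | zero => simp
  | tmul m c => simp [mul_apply]
  | add s t hs ht => simp [hs, ht]

lemma contract_contract {C : Type u} [AddCommGroup C] [Module R C] [Module Rᵐᵒᵖ C]
    [SMulCommClass R Rᵐᵒᵖ C] (f g : LeftDual R C) (s : BTensor R (BTensor R M C) C) :
    contract g (contract f s) =
      contract g (BTensor.map LinearMap.id (contractLeft f) (BTensor.assoc M C C s)) := by
  induction s using BTensor.induction_on with
  | zero => simp
  | tmul s c =>
    induction s using BTensor.induction_on with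
    | zero => simp
    | tmul m d => simp [BTensor.op_smul_tmul, contractLeft]
    | add s t hs ht =>
      rw [BTensor.add_tmul]; simp only [map_add, hs, ht]
  | add s t hs ht => simp only [map_add, hs, ht]

/-- For a coassociative coaction, acting by `f ⋆ g` is acting by `f` and then by `g`. -/
lemma contract_mul (f g : LeftDual R C) (ϱ : M →ₗ[Rᵐᵒᵖ] BTensor R M C) (m : M)
    (h : BTensor.assoc M C C (BTensor.map ϱ LinearMap.id (ϱ m)) =
      BTensor.map LinearMap.id (Coring.comul (R := R)).toLinearMap (ϱ m)) :
    contract (f * g) (ϱ m) = contract g (ϱ (contract f (ϱ m))) := by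
  rw [← contract_map, contract_contract, h, ← contract_map_translate]
  congr 1
  generalize ϱ m = t
  induction t using BTensor.induction_on with
  | zero => simp
  | tmul m c => rfl
  | add s t hs ht => simp only [map_add, hs, ht]

lemma translate_mul (f g : LeftDual R C) (c : C) :
    translate (f * g) c = translate g (translate f c) :=
  contract_mul f g (Coring.comul (R := R) (C := C)).right c (Coring.coassoc c)

lemma translate_one (c : C) : translate (1 : LeftDual R C) c = c := by
  rw [translate_apply, contract_one]
  exact Coring.counit_right c

lemma counit_translate (f : LeftDual R C) (c : C) :
    (Coring.counit (R := R)).toLinearMap (translate f c) = f c := by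
  conv_rhs => rw [← Coring.counit_left (R := R) c]
  rw [translate_apply]
  generalize (Coring.comul (R := R)).toLinearMap c = t
  induction t using BTensor.induction_on with
  | zero => simp
  | tmul c d =>
    have := (Coring.counit (R := R) (C := C)).map_op_smul' (f d) c
    simpa using this
  | add s t hs ht => simp only [map_add, hs, ht]

/-- The left dual ring `*C` of a coring. -/
instance : Ring (LeftDual R C) where
  __ := (inferInstance : AddCommGroup (LeftDual R C))
  left_distrib f g h := rfl
  right_distrib f g h := by
    ext c
    simp only [mul_apply, add_apply, translate_apply, contract_add, map_add]
  zero_mul f := by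
    ext c
    have : contract (0 : LeftDual R C) ((Coring.comul (R := R)).toLinearMap c) = 0 := by
      simpa using contract_add (0 : LeftDual R C) 0 ((Coring.comul (R := R)).toLinearMap c)
    simp only [mul_apply, translate_apply, this, map_zero, zero_apply]
  mul_zero f := rfl
  mul_assoc f g h := by ext c; simp only [mul_apply, translate_mul]
  one_mul f := by ext c; simp only [mul_apply, translate_one]
  mul_one f := by ext c; rw [mul_apply, one_apply, counit_translate]

end LeftDual

/-- Compatibility of a unital ring structure and an `R`-bimodule structure on `A`, saying that the
multiplication is an `R`-bilinear map `A ⊗_R A → A`, i.e. that `A` is an `R`-ring with unity. -/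
class RRing (A : Type u) [Ring A] [Module R A] [Module Rᵐᵒᵖ A] : Prop
    extends SMulCommClass R Rᵐᵒᵖ A where
  smul_mul : ∀ (r : R) (a b : A), (r • a) * b = r • (a * b)
  mul_op_smul : ∀ (r : R) (a b : A), a * (op r • b) = op r • (a * b)
  op_smul_mul : ∀ (r : R) (a b : A), (op r • a) * b = a * (r • b)

variable {R} in
/-- `*C` is an `R`-ring. -/
instance {C : Type u} [AddCommGroup C] [Module R C] [Module Rᵐᵒᵖ C] [SMulCommClass R Rᵐᵒᵖ C]
    [Coring R C] : RRing R (LeftDual R C) where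
  smul_mul r f g := by
    ext c
    rw [LeftDual.mul_apply, LeftDual.smul_apply, LeftDual.mul_apply, LeftDual.translate_apply,
      LeftDual.translate_apply, LeftDual.contract_smul]
    congr 2
    exact ((Coring.comul (R := R) (C := C)).map_op_smul' r c).symm
  mul_op_smul r f g := rfl
  op_smul_mul r f g := by
    ext c
    rw [LeftDual.mul_apply, LeftDual.mul_apply, LeftDual.translate_apply,
      LeftDual.contract_op_smul]
    rfl

end Corings

section Pairings

/-! ### Pairings, the `α`-condition, local projectivity, density -/

variable {R : Type u} [Ring R]

/-- A left `R`-module `W` is locally projective: for every surjective `π : L → N`, every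
`g : W → N` and every finitely generated `F ⊆ W` there is `g' : W → L` with `π ∘ g' = g` on `F`. -/
def LocallyProjective (R W : Type u) [Ring R] [AddCommGroup W] [Module R W] : Prop :=
  ∀ (L N : Type u) [AddCommGroup L] [Module R L] [AddCommGroup N] [Module R N]
    (π : L →ₗ[R] N) (_ : Function.Surjective π) (g : W →ₗ[R] N) (F : Submodule R W) (_ : F.FG),
    ∃ g' : W →ₗ[R] L, ∀ w ∈ F, π (g' w) = g w

section

variable {V W : Type u} [AddCommGroup V] [Module Rᵐᵒᵖ V] [AddCommGroup W] [Module R W]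

/-- For a left `R`-pairing `κ : V → *W` and a right `R`-module `M`, the map
`α_M : M ⊗_R W → Hom_{-R}(V, M)`, `m ⊗ w ↦ [v ↦ m ⟨v, w⟩]`. -/
def alphaMap (κ : V →ₗ[Rᵐᵒᵖ] LeftDual R W) (M : Type u) [AddCommGroup M] [Module Rᵐᵒᵖ M] :
    BTensor R M W →+ (V →ₗ[Rᵐᵒᵖ] M) where
  toFun t :=
    { toFun := fun v => LeftDual.contract (κ v) t
      map_add' := fun v v' => by rw [map_add, LeftDual.contract_add]
      map_smul' := fun r v => by
        rw [map_smul]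
        exact LeftDual.contract_op_smul r.unop (κ v) t }
  map_zero' := by ext v; exact map_zero (LeftDual.contract (κ v))
  map_add' s t := by ext v; exact map_add (LeftDual.contract (κ v)) s t

@[simp] lemma alphaMap_tmul (κ : V →ₗ[Rᵐᵒᵖ] LeftDual R W) (M : Type u) [AddCommGroup M]
    [Module Rᵐᵒᵖ M] (m : M) (w : W) (v : V) :
    alphaMap κ M (BTensor.tmul R m w) v = op (κ v w) • m := rfl

lemma alphaMap_apply (κ : V →ₗ[Rᵐᵒᵖ] LeftDual R W) (M : Type u) [AddCommGroup M]
    [Module Rᵐᵒᵖ M] (t : BTensor R M W) (v : V) :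
    alphaMap κ M t v = LeftDual.contract (κ v) t := rfl

/-- The left `α`-condition for a left `R`-pairing. -/
def AlphaCondition (κ : V →ₗ[Rᵐᵒᵖ] LeftDual R W) : Prop :=
  ∀ (M : Type u) [AddCommGroup M] [Module Rᵐᵒᵖ M], Function.Injective (alphaMap κ M)

/-- The left `α`-condition for a left `R`-module `W`: that of the pairing `(*W, W)`. -/
def ModuleAlphaCondition (R W : Type u) [Ring R] [AddCommGroup W] [Module R W] : Prop :=
  AlphaCondition (LinearMap.id : LeftDual R W →ₗ[Rᵐᵒᵖ] LeftDual R W)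

/-- The finite topology on `*W`: the topology induced by the product topology on `R^W`, where `R`
is discrete. -/
@[reducible]
def finiteTopology (R W : Type u) [Ring R] [AddCommGroup W] [Module R W] :
    TopologicalSpace (LeftDual R W) :=
  TopologicalSpace.induced (fun f : LeftDual R W => (f : W → R))
    (@Pi.topologicalSpace W (fun _ => R) (fun _ => ⊥))

/-- The image of `κ : V → *W` is dense in `*W` for the finite topology. -/
def DensePairing (κ : V →ₗ[Rᵐᵒᵖ] LeftDual R W) : Prop :=
  @Dense _ (finiteTopology R W) (Set.range κ)

end

/-- A measuring left `R`-pairing `(A, C)`: an `R`-coring `C`, an `R`-ring `A` and a morphism of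
`R`-rings `κ : A → *C`. -/
structure MeasuringLeftPairing (R A C : Type u) [Ring R] [Ring A] [Module R A] [Module Rᵐᵒᵖ A]
    [RRing R A] [AddCommGroup C] [Module R C] [Module Rᵐᵒᵖ C] [SMulCommClass R Rᵐᵒᵖ C]
    [Coring R C] where
  /-- the morphism of rings `A → *C` -/
  κ : A →+* LeftDual R C
  map_smul : ∀ (r : R) (a : A), κ (r • a) = r • κ a
  map_op_smul : ∀ (r : R) (a : A), κ (op r • a) = op r • κ a

namespace MeasuringLeftPairing

variable {A C : Type u} [Ring A] [Module R A] [Module Rᵐᵒᵖ A] [RRing R A] [AddCommGroup C]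
  [Module R C] [Module Rᵐᵒᵖ C] [SMulCommClass R Rᵐᵒᵖ C] [Coring R C]

/-- The underlying left `R`-pairing. -/
def toPairing (P : MeasuringLeftPairing R A C) : A →ₗ[Rᵐᵒᵖ] LeftDual R C where
  toFun := P.κ
  map_add' := map_add P.κ
  map_smul' r a := P.map_op_smul r.unop a

lemma toPairing_apply (P : MeasuringLeftPairing R A C) (a : A) : P.toPairing a = P.κ a := rfl

variable (R C) in
/-- The measuring left `R`-pairing `(*C, C)`. -/
def dual : MeasuringLeftPairing R (LeftDual R C) C where
  κ := RingHom.id _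
  map_smul _ _ := rfl
  map_op_smul _ _ := rfl

end MeasuringLeftPairing

end Pairings

section Categories

/-! ### Categories of modules over an `R`-ring -/

/-- A right module over the `R`-ring `A`, not necessarily unital: a right `R`-module `M` with a
right `R`-linear map `ρ : M → Hom_{-R}(A, M)`, `ρ m a = m a`, such that `m (a b) = (m a) b`. -/
structure RightMod (R A : Type u) [Ring R] [Ring A] [Module R A] [Module Rᵐᵒᵖ A] where
  carrier : Type u
  [addCommGroup : AddCommGroup carrier]
  [module : Module Rᵐᵒᵖ carrier]
  ρ : carrier →+ (A →ₗ[Rᵐᵒᵖ] carrier)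
  ρ_smul : ∀ (m : carrier) (r : R) (a : A), ρ (op r • m) a = ρ m (r • a)
  ρ_mul : ∀ (m : carrier) (a b : A), ρ m (a * b) = ρ (ρ m a) b

namespace RightMod

attribute [instance] RightMod.addCommGroup RightMod.module

variable {R A : Type u} [Ring R] [Ring A] [Module R A] [Module Rᵐᵒᵖ A]

/-- `A`-linear maps. -/
@[ext]
structure Hom (M N : RightMod R A) where
  /-- the underlying map of right `R`-modules -/
  hom : M.carrier →ₗ[Rᵐᵒᵖ] N.carrier
  map_ρ : ∀ (m : M.carrier) (a : A), hom (M.ρ m a) = N.ρ (hom m) a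

instance : Category (RightMod R A) where
  Hom := Hom
  id M := ⟨LinearMap.id, fun _ _ => rfl⟩
  comp f g := ⟨g.hom.comp f.hom, fun m a => by simp [f.map_ρ, g.map_ρ]⟩

/-- `M` is unital: `M A = M`. -/
def unital : ObjectProperty (RightMod R A) := fun M =>
  AddSubgroup.closure {x | ∃ (m : M.carrier) (a : A), x = M.ρ m a} = ⊤

/-- `M` is `A`-faithful: `ρ : M → Hom_{-R}(A, M)` is injective. -/
def faithful : ObjectProperty (RightMod R A) := fun M => Function.Injective M.ρ

/-- The direct sum `M^(Λ)`. -/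
def directSum (M : RightMod R A) (Λ : Type u) : RightMod R A where
  carrier := Λ →₀ M.carrier
  ρ := AddMonoidHom.mk'
    (fun x =>
      { toFun := fun a => x.mapRange (fun m => M.ρ m a) (by simp)
        map_add' := fun a b => by ext i; simp
        map_smul' := fun r a => by ext i; simp })
    (fun x y => by ext a i; simp)
  ρ_smul x r a := by ext i; simp [M.ρ_smul]
  ρ_mul x a b := by ext i; simp [M.ρ_mul]

/-- `N` is `K`-generated: there is a surjective `A`-linear map `K^(Λ) → N` for some set `Λ`. -/
def generatedBy (K : RightMod R A) : ObjectProperty (RightMod R A) := fun N =>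
  ∃ (Λ : Type u) (f : K.directSum Λ ⟶ N), Function.Surjective f.hom

/-- The objects of `σ[K_A]`: the unital right `A`-modules which are isomorphic to a submodule of
a `K`-generated (unital) module. -/
def sigma (K : RightMod R A) : ObjectProperty (RightMod R A) := fun N =>
  unital N ∧ ∃ Q : RightMod R A, unital Q ∧ generatedBy K Q ∧
    ∃ f : N ⟶ Q, Function.Injective f.hom

end RightMod

/-! ### The category of right comodules -/

/-- A counital right comodule over a coring `C`. -/
structure Comod (R C : Type u) [Ring R] [AddCommGroup C] [Module R C] [Module Rᵐᵒᵖ C]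
    [SMulCommClass R Rᵐᵒᵖ C] [Coring R C] where
  carrier : Type u
  [addCommGroup : AddCommGroup carrier]
  [module : Module Rᵐᵒᵖ carrier]
  /-- the coaction -/
  ϱ : carrier →ₗ[Rᵐᵒᵖ] BTensor R carrier C
  coassoc : ∀ m, BTensor.assoc carrier C C (BTensor.map ϱ LinearMap.id (ϱ m)) =
    BTensor.map LinearMap.id (Coring.comul (R := R) (C := C)).toLinearMap (ϱ m)
  counital : Function.Injective ϱ

namespace Comod

attribute [instance] Comod.addCommGroup Comod.module

variable {R C : Type u} [Ring R] [AddCommGroup C] [Module R C] [Module Rᵐᵒᵖ C]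
    [SMulCommClass R Rᵐᵒᵖ C] [Coring R C]

/-- `C`-colinear maps. -/
@[ext]
structure Hom (M N : Comod R C) where
  /-- the underlying map of right `R`-modules -/
  hom : M.carrier →ₗ[Rᵐᵒᵖ] N.carrier
  map_ϱ : ∀ m : M.carrier, N.ϱ (hom m) = BTensor.map hom LinearMap.id (M.ϱ m)

/-- The category `M^C` of counital right `C`-comodules. -/
instance : Category (Comod R C) where
  Hom := Hom
  id M := ⟨LinearMap.id, fun m => (BTensor.map_id_id (M.ϱ m)).symm⟩
  comp f g := ⟨g.hom.comp f.hom, fun m => by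
    rw [LinearMap.comp_apply, g.map_ϱ, f.map_ϱ]
    generalize Comod.ϱ _ m = t
    induction t using BTensor.induction_on with
    | zero => simp
    | tmul m c => simp
    | add s t hs ht => simp only [map_add, hs, ht]⟩

variable (R C) in
/-- `C` as a right comodule over itself. -/
def regular : Comod R C where
  carrier := C
  ϱ := (Coring.comul (R := R) (C := C)).right
  coassoc := Coring.coassoc
  counital := fun c d h => by
    rw [← Coring.counit_right (R := R) c, ← Coring.counit_right (R := R) d]
    exact congrArg _ (congrArg _ h)

end Comod

namespace MeasuringLeftPairing

variable {R A C : Type u} [Ring R] [Ring A] [Module R A] [Module Rᵐᵒᵖ A] [RRing R A]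
  [AddCommGroup C] [Module R C] [Module Rᵐᵒᵖ C] [SMulCommClass R Rᵐᵒᵖ C] [Coring R C]
  (P : MeasuringLeftPairing R A C)

/-- The functor `M^C → Mod-A`, `(M, ϱ) ↦ (M, α_M ∘ ϱ)`, that is, `m a = ∑ m₀ ⟨a, m₁⟩`, which is
the identity on underlying maps. -/
def inducedModule : Comod R C ⥤ RightMod R A where
  obj M :=
    { carrier := M.carrier
      ρ := (alphaMap P.toPairing M.carrier).comp M.ϱ.toAddMonoidHom
      ρ_smul := fun m r a => by
        change LeftDual.contract (P.κ a) (M.ϱ (op r • m)) =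
          LeftDual.contract (P.κ (r • a)) (M.ϱ m)
        rw [P.map_smul, LeftDual.contract_smul, LinearMap.map_smul]
      ρ_mul := fun m a b => by
        change LeftDual.contract (P.κ (a * b)) (M.ϱ m) =
          LeftDual.contract (P.κ b) (M.ϱ (LeftDual.contract (P.κ a) (M.ϱ m)))
        rw [map_mul, LeftDual.contract_mul _ _ _ _ (M.coassoc m)] }
  map {M N} f := ⟨f.hom, fun m a => by
    change f.hom (LeftDual.contract (P.κ a) (M.ϱ m)) =
      LeftDual.contract (P.κ a) (N.ϱ (f.hom m))
    rw [f.map_ϱ, LeftDual.contract_map]⟩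

/-- `C` as a right `A`-module: `c ↼ a = ∑ c₁ ⟨a, c₂⟩`. -/
def coringModule : RightMod R A := P.inducedModule.obj (Comod.regular R C)

/-- `σ[C_A]`. -/
def sigma : ObjectProperty (RightMod R A) := RightMod.sigma P.coringModule

/-- `Rat^C(M_A) = ρ⁻¹(M ⊗_R C)`: the elements `m` such that for some `∑ mᵢ ⊗ cᵢ` in `M ⊗_R C`
one has `m a = ∑ mᵢ ⟨a, cᵢ⟩` for all `a`. -/
def ratPart (M : RightMod R A) : Set M.carrier :=
  {m | ∃ t : BTensor R M.carrier C, M.ρ m = alphaMap P.toPairing M.carrier t}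

/-- `M` is `C`-rational: `Rat^C(M_A) = M`. -/
def rational : ObjectProperty (RightMod R A) := fun M => P.ratPart M = Set.univ

/-- The `A`-faithful `C`-rational modules. -/
def ratFaithful : ObjectProperty (RightMod R A) := RightMod.faithful ⊓ P.rational

/-- The unital `C`-rational modules. -/
def ratUnital : ObjectProperty (RightMod R A) := RightMod.unital ⊓ P.rational

end MeasuringLeftPairing

/-! ### Isomorphisms of categories -/

/-- `F` is an isomorphism of categories. -/
def IsIsoOfCategories {𝓒 𝓓 : Type*} [Category 𝓒] [Category 𝓓] (F : 𝓒 ⥤ 𝓓) : Prop :=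
  ∃ G : 𝓓 ⥤ 𝓒, F ⋙ G = 𝟭 𝓒 ∧ G ⋙ F = 𝟭 𝓓

/-- `F` takes values in the full subcategory `p` and induces an isomorphism of categories
from its source onto that subcategory. -/
def InducesIsoOnto {𝓒 𝓓 : Type*} [Category 𝓒] [Category 𝓓] (F : 𝓒 ⥤ 𝓓)
    (p : ObjectProperty 𝓓) : Prop :=
  ∃ h : ∀ X, p (F.obj X), IsIsoOfCategories (p.lift F h)

end Categories

end Corings

end

open Corings

/-! The hinge is a finite condition, `HasLocalDualBases`: on any finite set S of elements of C, the
identity has the form c = ∑ ⟨aᵢ, c⟩ uᵢ with finitely many aᵢ in A and uᵢ in C.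

Conditions 1, 2 and 3 all unwind to it. Given local dual bases, a tensor t is recovered from its
contractions as ∑ t(aᵢ) ⊗ uᵢ, which gives the α-condition. Conversely, the α-condition and right
exactness of the tensor product, applied to ∑ e_c ⊗ c in R^S ⊗ C, produce a dual basis on S
(`AlphaCondition.hasLocalDualBases`). Local dual bases from A amount to local dual bases from the
full dual together with density (`hasLocalDualBases_iff_dense`), and those from the full dual are
local projectivity (`locallyProjective_iff_hasLocalDualBases`).

For 3 → 4, injectivity of the α-maps lets a unital rational module carry exactly one coaction, and
makes A-linear maps colinear (`exists_comod_eq`, `inducedModule_full`). Every comodule embeds by its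
coaction into M ⊗ C, a quotient of C^(M), so it lies in σ[C]; conversely rationality passes from C
to direct sums, quotients and, by dual bases, submodules (`ratUnital_eq_sigma`).

For 4 → 3, the cyclic submodule of C^(C) generated by an element with coordinates c in S is
isomorphic to the module of a comodule. Fullness makes its coordinate projections colinear, so one
coaction formula gives Δ(c) = ∑ c aᵢ ⊗ uᵢ for all c in S at once, and the counit turns it into a
dual basis (`hasLocalDualBases_of_inducesIsoOnto`). -/

noncomputable section

namespace Corings

/-! ### Finite sums of pure tensors and right exactness. -/

namespace BTensor

variable {R : Type u} [Ring R] {M M' N : Type u} [AddCommGroup M] [Module Rᵐᵒᵖ M]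
  [AddCommGroup M'] [Module Rᵐᵒᵖ M'] [AddCommGroup N] [Module R N]

lemma exists_eq_sum_tmul (t : BTensor R M N) :
    ∃ (n : ℕ) (m : Fin n → M) (w : Fin n → N), t = ∑ i, tmul R (m i) (w i) := by
  induction t using induction_on with
  | zero => exact ⟨0, Fin.elim0, Fin.elim0, by simp⟩
  | tmul m n => exact ⟨1, fun _ => m, fun _ => n, by simp⟩
  | add s t hs ht =>
    obtain ⟨k, m, w, rfl⟩ := hs
    obtain ⟨l, m', w', rfl⟩ := ht
    exact ⟨k + l, Fin.append m m', Fin.append w w', by simp [Fin.sum_univ_add]⟩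

lemma tmul_sum {ι : Type*} (s : Finset ι) (m : M) (w : ι → N) :
    tmul R m (∑ i ∈ s, w i) = ∑ i ∈ s, tmul R m (w i) :=
  map_sum (mkHom (R := R) m) w s

/-- Auxiliary map for the right exactness of the tensor product:
`(M / K) ⊗_R N → (M ⊗_R N) / im (K ⊗_R N)`. -/
def quotientMap (K : Submodule Rᵐᵒᵖ M) : BTensor R (M ⧸ K) N →+
    BTensor R M N ⧸ (map K.subtype (LinearMap.id : N →ₗ[R] N)).range :=
  lift
    (QuotientAddGroup.lift K.toAddSubgroup
      (AddMonoidHom.mk' (fun m => (QuotientAddGroup.mk' _).comp (mkHom m))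
        (fun m m' => by rw [map_add, AddMonoidHom.comp_add])) (fun m hm => by
          ext n
          exact (QuotientAddGroup.eq_zero_iff _).2 ⟨tmul R ⟨m, hm⟩ n, rfl⟩))
    (fun m r n => by
      obtain ⟨m, rfl⟩ := K.mkQ_surjective m
      exact congrArg (QuotientAddGroup.mk' _) (smul_tmul m r n))

/-- Right exactness of the tensor product in the first variable. -/
lemma mem_range_of_map_mkQ_eq_zero (K : Submodule Rᵐᵒᵖ M) (t : BTensor R M N)
    (ht : map K.mkQ LinearMap.id t = 0) :
    t ∈ (map K.subtype (LinearMap.id : N →ₗ[R] N)).range := by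
  -- The projection onto the cokernel of K ⊗ N → M ⊗ N factors through (M / K) ⊗ N, so it kills t.
  have h : (quotientMap K).comp (map K.mkQ (LinearMap.id : N →ₗ[R] N)) =
      QuotientAddGroup.mk' _ := addHom_ext fun m n => rfl
  have h' := DFunLike.congr_fun h t
  rw [AddMonoidHom.comp_apply, ht, map_zero] at h'
  exact (QuotientAddGroup.eq_zero_iff _).1 h'.symm

/-- The left linear map `n ↦ n ⊗ l`. -/
def tmulRight {L : Type u} [Module Rᵐᵒᵖ N] [SMulCommClass R Rᵐᵒᵖ N] [AddCommGroup L]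
    [Module R L] (l : L) : N →ₗ[R] BTensor R N L where
  toFun n := tmul R n l
  map_add' n n' := add_tmul n n' l
  map_smul' r n := (smul_tmul' r n l).symm

end BTensor

section LocalDualBases

/-! ### Local dual bases -/

variable {R : Type u} [Ring R] {V W : Type u} [AddCommGroup V] [Module Rᵐᵒᵖ V]
  [AddCommGroup W] [Module R W]

/-- `w = ∑ i, ⟨v i, w⟩ u i` for all `w ∈ S`. -/
def IsDualBasisOn (κ : V →ₗ[Rᵐᵒᵖ] LeftDual R W) (S : Finset W) {n : ℕ} (v : Fin n → V)
    (u : Fin n → W) : Prop :=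
  ∀ w ∈ S, ∑ i, κ (v i) w • u i = w

/-- Every finite subset of `W` has a dual basis taken from the pairing. -/
def HasLocalDualBases (κ : V →ₗ[Rᵐᵒᵖ] LeftDual R W) : Prop :=
  ∀ S : Finset W, ∃ (n : ℕ) (v : Fin n → V) (u : Fin n → W), IsDualBasisOn κ S v u

lemma IsDualBasisOn.mono {κ : V →ₗ[Rᵐᵒᵖ] LeftDual R W} {S T : Finset W} (h : S ⊆ T) {n : ℕ}
    {v : Fin n → V} {u : Fin n → W} (H : IsDualBasisOn κ T v u) : IsDualBasisOn κ S v u :=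
  fun w hw => H w (h hw)

/-- A dual basis on a large enough finite set recovers a tensor from its contractions. -/
lemma exists_finset_eq_sum_contract (κ : V →ₗ[Rᵐᵒᵖ] LeftDual R W) {M : Type u} [AddCommGroup M]
    [Module Rᵐᵒᵖ M] (t : BTensor R M W) :
    ∃ S : Finset W, ∀ (n : ℕ) (v : Fin n → V) (u : Fin n → W), IsDualBasisOn κ S v u →
      t = ∑ i, BTensor.tmul R (LeftDual.contract (κ (v i)) t) (u i) := by
  classical
  induction t using BTensor.induction_on with
  | zero => exact ⟨∅, fun n v u _ => by simp⟩
  | tmul m w =>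
    refine ⟨{w}, fun n v u H => ?_⟩
    -- Expand w along the dual basis; balancedness then moves the scalars onto m, where they form
    -- the contractions.
    conv_lhs => rw [← H w (by simp), BTensor.tmul_sum]
    simp only [LeftDual.contract_tmul, BTensor.smul_tmul]
  | add s t hs ht =>
    obtain ⟨S, hS⟩ := hs
    obtain ⟨T, hT⟩ := ht
    refine ⟨S ∪ T, fun n v u H => ?_⟩
    simp only [map_add, BTensor.add_tmul, Finset.sum_add_distrib]
    rw [← hS n v u (H.mono Finset.subset_union_left),
      ← hT n v u (H.mono Finset.subset_union_right)]

lemma HasLocalDualBases.exists_eq_sum_contract {κ : V →ₗ[Rᵐᵒᵖ] LeftDual R W}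
    (H : HasLocalDualBases κ) {M : Type u} [AddCommGroup M] [Module Rᵐᵒᵖ M]
    (t : BTensor R M W) : ∃ (n : ℕ) (v : Fin n → V) (u : Fin n → W),
      t = ∑ i, BTensor.tmul R (LeftDual.contract (κ (v i)) t) (u i) := by
  obtain ⟨S, hS⟩ := exists_finset_eq_sum_contract κ t
  obtain ⟨n, v, u, h⟩ := H S
  exact ⟨n, v, u, hS n v u h⟩

/-- The coefficients of t along a dual basis are its contractions, and these vanish when the α-map
kills t. -/
lemma HasLocalDualBases.alphaCondition {κ : V →ₗ[Rᵐᵒᵖ] LeftDual R W}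
    (H : HasLocalDualBases κ) : AlphaCondition κ := by
  intro M _ _
  rw [injective_iff_map_eq_zero]
  intro t ht
  obtain ⟨n, v, u, h⟩ := H.exists_eq_sum_contract t
  rw [h]
  refine Finset.sum_eq_zero fun i _ => ?_
  rw [← alphaMap_apply, ht, LinearMap.zero_apply, BTensor.zero_tmul]

/-- The tensors on which all functionals take values in a submodule `K` come from `K ⊗_R W`. -/
lemma AlphaCondition.mem_range {κ : V →ₗ[Rᵐᵒᵖ] LeftDual R W} (H : AlphaCondition κ)
    {M : Type u} [AddCommGroup M] [Module Rᵐᵒᵖ M] (K : Submodule Rᵐᵒᵖ M) (t : BTensor R M W)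
    (ht : ∀ v, LeftDual.contract (κ v) t ∈ K) :
    t ∈ (BTensor.map K.subtype (LinearMap.id : W →ₗ[R] W)).range := by
  refine BTensor.mem_range_of_map_mkQ_eq_zero K t (H (M ⧸ K) ?_)
  ext v
  rw [alphaMap_apply, LeftDual.contract_map, map_zero]
  exact (Submodule.Quotient.mk_eq_zero K).2 (ht v)

/-- Evaluation of the functionals `⟨v, -⟩` at the elements of `S`. -/
def evalOn (κ : V →ₗ[Rᵐᵒᵖ] LeftDual R W) (S : Finset W) : V →ₗ[Rᵐᵒᵖ] (S → R) where
  toFun v w := κ v w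
  map_add' v v' := by ext w; simp
  map_smul' r v := by ext w; rw [map_smul]; rfl

/-- The tensor ∑ e_w ⊗ w in R^S ⊗ W contracts against v to the vector of values of v on S. All
contractions thus lie in the image K of V in R^S, so the tensor comes from K ⊗ W; preimages in V of
its left components form the dual basis. -/
lemma AlphaCondition.hasLocalDualBases {κ : V →ₗ[Rᵐᵒᵖ] LeftDual R W} (H : AlphaCondition κ) :
    HasLocalDualBases κ := by
  classical
  intro S
  let t : BTensor R (S → R) W := ∑ w : S, BTensor.tmul R (Pi.single w 1) (w : W)
  have ht : ∀ v, LeftDual.contract (κ v) t = evalOn κ S v := by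
    intro v
    ext w
    simp [t, evalOn, Pi.single_apply]
  obtain ⟨s, hs⟩ := H.mem_range (LinearMap.range (evalOn κ S)) t fun v => ⟨v, (ht v).symm⟩
  obtain ⟨n, x, u, rfl⟩ := BTensor.exists_eq_sum_tmul s
  choose v hv using fun i => (x i).2
  refine ⟨n, v, u, fun w hw => ?_⟩
  -- Projecting R^S to the coordinate w sends the universal tensor to w and the other expression to
  -- the dual basis sum.
  have key := congrArg (fun z => BTensor.lid W
    (BTensor.map (LinearMap.proj (⟨w, hw⟩ : S)) LinearMap.id z)) hs
  simp only [map_sum, t, BTensor.map_tmul, BTensor.lid_tmul, Submodule.subtype_apply, ← hv,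
    LinearMap.proj_apply, LinearMap.id_apply, Pi.single_apply, ite_smul, one_smul, zero_smul,
    Finset.sum_ite_eq, Finset.mem_univ, if_true] at key
  exact key

lemma alphaCondition_iff_hasLocalDualBases (κ : V →ₗ[Rᵐᵒᵖ] LeftDual R W) :
    AlphaCondition κ ↔ HasLocalDualBases κ :=
  ⟨AlphaCondition.hasLocalDualBases, HasLocalDualBases.alphaCondition⟩

/-- As R is discrete, the functionals agreeing with f on a finite set form a neighbourhood basis of
f. -/
lemma densePairing_iff (κ : V →ₗ[Rᵐᵒᵖ] LeftDual R W) :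
    DensePairing κ ↔ ∀ (f : LeftDual R W) (S : Finset W), ∃ v, ∀ w ∈ S, κ v w = f w := by
  let _ : TopologicalSpace R := ⊥
  have : DiscreteTopology R := ⟨rfl⟩
  refine forall_congr' fun f => ?_
  refine (closure_induced (t := Pi.topologicalSpace) (f := fun f : LeftDual R W => (f : W → R))
    (a := f) (s := Set.range κ)).trans ?_
  rw [mem_closure_iff]
  constructor
  · intro h S
    obtain ⟨_, hg, _, ⟨v, rfl⟩, rfl⟩ := h (Set.pi S fun w => {f w})
      (isOpen_set_pi S.finite_toSet fun _ _ => isOpen_discrete _) (fun w _ => rfl)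
    exact ⟨v, hg⟩
  · intro h o ho hf
    obtain ⟨S, U, hU, hS⟩ := isOpen_pi_iff.1 ho _ hf
    obtain ⟨v, hv⟩ := h S
    refine ⟨_, hS fun w hw => ?_, _, ⟨v, rfl⟩, rfl⟩
    change κ v w ∈ U w
    rw [hv w hw]
    exact (hU w hw).2

lemma hasLocalDualBases_iff_dense (κ : V →ₗ[Rᵐᵒᵖ] LeftDual R W) :
    HasLocalDualBases κ ↔
      HasLocalDualBases (LinearMap.id : LeftDual R W →ₗ[Rᵐᵒᵖ] LeftDual R W) ∧
        DensePairing κ := by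
  classical
  rw [densePairing_iff]
  refine ⟨fun H => ⟨fun S => ?_, fun f S => ?_⟩, fun ⟨H, D⟩ S => ?_⟩
  · obtain ⟨n, v, u, h⟩ := H S
    exact ⟨n, fun i => κ (v i), u, h⟩
  · obtain ⟨n, v, u, h⟩ := H S
    -- Applying f to w = ∑ ⟨vᵢ, w⟩ uᵢ shows that ∑ vᵢ f(uᵢ) agrees with f on S.
    refine ⟨∑ i, op (f (u i)) • v i, fun w hw => ?_⟩
    conv_rhs => rw [← h w hw, map_sum]
    rw [map_sum]
    have hsum : ∀ (s : Finset (Fin n)) (F : Fin n → LeftDual R W),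
        (∑ i ∈ s, F i) w = ∑ i ∈ s, F i w := fun s F =>
      map_sum (AddMonoidHom.mk' (fun g : LeftDual R W => g w) fun _ _ => rfl) F s
    rw [hsum]
    refine Finset.sum_congr rfl fun i _ => ?_
    rw [map_smul, map_smul, LeftDual.op_smul_apply, smul_eq_mul]
  · obtain ⟨n, f, u, h⟩ := H S
    -- Only the values on S enter the dual basis identity, so each functional may be replaced by one
    -- from V agreeing with it there.
    choose v hv using fun i => D (f i) S
    refine ⟨n, v, u, fun w hw => ?_⟩
    conv_rhs => rw [← h w hw]
    exact Finset.sum_congr rfl fun i _ => by rw [hv i w hw]; rfl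

/-- A dual basis is a lift of the identity, on the span of S, through the free module on W;
conversely a dual basis lets one lift any g by lifting the finitely many g(uᵢ). -/
lemma locallyProjective_iff_hasLocalDualBases :
    LocallyProjective R W ↔
      HasLocalDualBases (LinearMap.id : LeftDual R W →ₗ[Rᵐᵒᵖ] LeftDual R W) := by
  classical
  constructor
  · intro H S
    obtain ⟨g, hg⟩ := H (W →₀ R) W (Finsupp.linearCombination R id)
      (Finsupp.linearCombination_id_surjective R W) LinearMap.id (Submodule.span R S)
      ⟨S, rfl⟩
    -- One finite index set must serve all of S, hence the union of the supports.
    let T : Finset W := S.biUnion fun w => (g w).support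
    refine ⟨T.card, fun i => (Finsupp.lapply (T.equivFin.symm i : W)).comp g,
      fun i => T.equivFin.symm i, fun w hw => ?_⟩
    have h := hg w (Submodule.subset_span hw)
    rw [Finsupp.linearCombination_apply, Finsupp.sum_of_support_subset (s := T) _
      (Finset.subset_biUnion_of_mem (fun w => (g w).support) hw) _ (by simp)] at h
    rw [← Finset.sum_coe_sort] at h
    rw [← T.equivFin.symm.sum_comp] at h
    exact h
  · intro H L N _ _ _ _ π hπ g F hF
    obtain ⟨S, rfl⟩ := hF
    obtain ⟨n, f, u, h⟩ := H S
    choose l hl using fun i => hπ (g (u i))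
    refine ⟨∑ i, (show W →ₗ[R] R from f i).smulRight (l i), fun w hw => ?_⟩
    have hw' : ∑ i, (f i) w • u i = w := by
      induction hw using Submodule.span_induction with
      | mem w hw => exact h w hw
      | zero => simp
      | add x y _ _ hx hy =>
        conv_rhs => rw [← hx, ← hy]
        simp only [map_add, add_smul, Finset.sum_add_distrib]
      | smul r x _ hx =>
        conv_rhs => rw [← hx]
        simp only [map_smul, smul_eq_mul, mul_smul, Finset.smul_sum]
    conv_rhs => rw [← hw']
    simp only [LinearMap.sum_apply, map_sum, map_smul]
    refine Finset.sum_congr rfl fun i _ => ?_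
    rw [← hl]
    exact π.map_smul (f i w) (l i)

end LocalDualBases

section Isomorphisms

/-! ### Isomorphisms of categories -/

variable {𝓒 𝓓 : Type*} [Category 𝓒] [Category 𝓓]

lemma IsIsoOfCategories.isEquivalence {F : 𝓒 ⥤ 𝓓} (h : IsIsoOfCategories F) :
    F.IsEquivalence := by
  obtain ⟨G, h₁, h₂⟩ := h
  exact (CategoryTheory.Equivalence.mk F G (eqToIso h₁.symm) (eqToIso h₂)).isEquivalence_functor

/-- A fully faithful functor which is bijective on objects is an isomorphism of categories. -/
lemma isIsoOfCategories_of_bijective (F : 𝓒 ⥤ 𝓓) [F.Full] [F.Faithful]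
    (h : Function.Bijective F.obj) : IsIsoOfCategories F := by
  let e := Equiv.ofBijective F.obj h
  have he : ∀ Y, F.obj (e.symm Y) = Y := e.apply_symm_apply
  let G : 𝓓 ⥤ 𝓒 :=
    { obj := e.symm
      -- The objects agree only propositionally, so f is conjugated by `eqToHom` before taking its
      -- preimage.
      map := fun {X Y} f => F.preimage (eqToHom (he X) ≫ f ≫ eqToHom (he Y).symm)
      map_id := fun X => F.map_injective (by simp)
      map_comp := fun f g => F.map_injective (by simp) }
  refine ⟨G, ?_, ?_⟩
  · refine CategoryTheory.Functor.ext (fun X => e.symm_apply_apply X) fun X Y f => F.map_injective ?_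
    simp only [Functor.comp_map, Functor.id_map, Functor.map_comp, Functor.map_preimage, G]
    congr 1
    · exact (eqToHom_map F _).symm
    · exact congrArg _ (eqToHom_map F _).symm
  · refine CategoryTheory.Functor.ext he fun X Y f => ?_
    simp [G]

/-- A criterion for inducing an isomorphism onto a full subcategory. -/
lemma inducesIsoOnto_of (F : 𝓒 ⥤ 𝓓) (p : ObjectProperty 𝓓) [F.Full] [F.Faithful]
    (hp : ∀ X, p (F.obj X)) (hinj : Function.Injective F.obj)
    (hsurj : ∀ Y, p Y → ∃ X, F.obj X = Y) : InducesIsoOnto F p := by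
  refine ⟨hp, isIsoOfCategories_of_bijective _ ⟨fun X Y h => ?_, fun Y => ?_⟩⟩
  · exact hinj (congrArg ObjectProperty.FullSubcategory.obj h)
  · obtain ⟨X, hX⟩ := hsurj Y.obj Y.property
    exact ⟨X, ObjectProperty.FullSubcategory.ext hX⟩

/-- The functor is an equivalence onto a full subcategory followed by the inclusion. -/
lemma InducesIsoOnto.full {F : 𝓒 ⥤ 𝓓} {p : ObjectProperty 𝓓} (h : InducesIsoOnto F p) :
    F.Full := by
  obtain ⟨hp, h⟩ := h
  have := h.isEquivalence
  exact inferInstanceAs (p.lift F hp ⋙ p.ι).Full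

lemma InducesIsoOnto.exists_iso {F : 𝓒 ⥤ 𝓓} {p : ObjectProperty 𝓓} (h : InducesIsoOnto F p)
    {Y : 𝓓} (hY : p Y) : ∃ X, Nonempty (F.obj X ≅ Y) := by
  obtain ⟨hp, h⟩ := h
  have := h.isEquivalence
  exact ⟨_, ⟨p.ι.mapIso ((p.lift F hp).objObjPreimageIso ⟨Y, hY⟩)⟩⟩

end Isomorphisms

section Modules

/-! ### Modules over an `R`-ring -/

namespace RightMod

variable {R A : Type u} [Ring R] [Ring A] [Module R A] [Module Rᵐᵒᵖ A]

@[simp] lemma comp_hom {M N L : RightMod R A} (f : M ⟶ N) (g : N ⟶ L) :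
    (f ≫ g).hom = g.hom.comp f.hom := rfl

lemma hom_injective_of_iso {M N : RightMod R A} (e : M ≅ N) : Function.Injective e.hom.hom :=
  Function.LeftInverse.injective (g := e.inv.hom) fun m => by
    rw [← LinearMap.comp_apply, ← comp_hom, e.hom_inv_id]; rfl

lemma hom_surjective_of_iso {M N : RightMod R A} (e : M ≅ N) : Function.Surjective e.hom.hom :=
  Function.RightInverse.surjective (g := e.inv.hom) fun n => by
    rw [← LinearMap.comp_apply, ← comp_hom, e.inv_hom_id]; rfl

/-- Isomorphism of categories demands literal equality of objects; this supplies it when the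
carriers already coincide. -/
lemma eq_of_ρ_eq {M : RightMod R A} (ρ : M.carrier →+ (A →ₗ[Rᵐᵒᵖ] M.carrier))
    (h₁ : ∀ (m : M.carrier) (r : R) (a : A), ρ (op r • m) a = ρ m (r • a))
    (h₂ : ∀ (m : M.carrier) (a b : A), ρ m (a * b) = ρ (ρ m a) b) (h : ρ = M.ρ) :
    (⟨M.carrier, ρ, h₁, h₂⟩ : RightMod R A) = M := by
  subst h
  rfl

lemma unital_iff (M : RightMod R A) : unital M ↔ ∀ m : M.carrier, M.ρ m 1 = m := by
  constructor
  · intro h m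
    have hm : m ∈ AddSubgroup.closure {x | ∃ (m : M.carrier) (a : A), x = M.ρ m a} :=
      h ▸ AddSubgroup.mem_top m
    induction hm using AddSubgroup.closure_induction with
    | mem x hx => obtain ⟨m, a, rfl⟩ := hx; rw [← M.ρ_mul, mul_one]
    | zero => simp
    | add x y _ _ hx hy => simp [hx, hy]
    | neg x _ hx => simp [hx]
  · intro h
    exact (AddSubgroup.eq_top_iff' _).2 fun m => AddSubgroup.subset_closure ⟨m, 1, (h m).symm⟩

/-- Since (m1)a = ma, the elements m1 and m act alike; faithfulness identifies them. Hence faithful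
and unital coincide. -/
lemma faithful_iff (M : RightMod R A) : faithful M ↔ ∀ m : M.carrier, M.ρ m 1 = m := by
  constructor
  · intro h m
    refine h ?_
    ext a
    rw [← M.ρ_mul, one_mul]
  · intro h m n hmn
    rw [← h m, ← h n, hmn]

lemma faithful_eq_unital : (faithful : ObjectProperty (RightMod R A)) = unital := by
  ext M
  rw [faithful_iff, unital_iff]

lemma unital.directSum {M : RightMod R A} (h : unital M) (Λ : Type u) :
    unital (M.directSum Λ) := by
  rw [unital_iff] at h ⊢
  exact fun x : Λ →₀ M.carrier => Finsupp.ext fun i => h (x i)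

/-- The `i`-th projection of a direct sum. -/
def directSumProj (M : RightMod R A) (Λ : Type u) (i : Λ) : M.directSum Λ ⟶ M where
  hom := (Finsupp.lapply i : (Λ →₀ M.carrier) →ₗ[Rᵐᵒᵖ] M.carrier)
  map_ρ _ _ := rfl

lemma generatedBy_directSum (M : RightMod R A) (Λ : Type u) :
    generatedBy M (M.directSum Λ) :=
  ⟨Λ, 𝟙 _, Function.surjective_id⟩

/-- The submodule `x A` of `M`. -/
def cyclic (M : RightMod R A) (x : M.carrier) : RightMod R A where
  carrier := LinearMap.range (M.ρ x)
  ρ := AddMonoidHom.mk'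
    (fun m => (M.ρ m).codRestrict (LinearMap.range (M.ρ x)) fun a => by
      obtain ⟨_, b, rfl⟩ := m
      exact ⟨b * a, M.ρ_mul x b a⟩)
    (fun m n => by ext a; simp)
  ρ_smul m r a := Subtype.ext (M.ρ_smul m r a)
  ρ_mul m a b := Subtype.ext (M.ρ_mul m a b)

/-- The inclusion of `x A` in `M`. -/
def cyclicι (M : RightMod R A) (x : M.carrier) : M.cyclic x ⟶ M where
  hom := (LinearMap.range (M.ρ x)).subtype
  map_ρ _ _ := rfl

lemma unital.cyclic {M : RightMod R A} (h : unital M) (x : M.carrier) : unital (M.cyclic x) := by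
  rw [unital_iff] at h ⊢
  exact fun m => Subtype.ext (h m.1)

lemma sigma_cyclic_directSum {K : RightMod R A} (h : unital K) (Λ : Type u)
    (x : Λ →₀ K.carrier) : sigma K ((K.directSum Λ).cyclic x) :=
  ⟨(h.directSum Λ).cyclic x, K.directSum Λ, h.directSum Λ, K.generatedBy_directSum Λ,
    (K.directSum Λ).cyclicι x, Subtype.val_injective⟩

end RightMod

end Modules

section Comodules

/-! ### Comodules and rational modules -/

lemma BTensor.map_map {R : Type u} [Ring R] {M M' M'' N N' N'' : Type u} [AddCommGroup M]
    [Module Rᵐᵒᵖ M] [AddCommGroup M'] [Module Rᵐᵒᵖ M'] [AddCommGroup M''] [Module Rᵐᵒᵖ M'']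
    [AddCommGroup N] [Module R N] [AddCommGroup N'] [Module R N'] [AddCommGroup N'']
    [Module R N''] (f' : M' →ₗ[Rᵐᵒᵖ] M'') (g' : N' →ₗ[R] N'') (f : M →ₗ[Rᵐᵒᵖ] M')
    (g : N →ₗ[R] N') (t : BTensor R M N) :
    map f' g' (map f g t) = map (f'.comp f) (g'.comp g) t :=
  DFunLike.congr_fun (f := (map f' g').comp (map f g))
    (g := map (f'.comp f) (g'.comp g)) (addHom_ext fun _ _ => rfl) t

/-! ### Contractions of triple tensor products. -/

namespace LeftDual

variable {R : Type u} [Ring R] {M N W : Type u} [AddCommGroup M] [Module Rᵐᵒᵖ M]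
  [AddCommGroup N] [Module R N] [Module Rᵐᵒᵖ N] [SMulCommClass R Rᵐᵒᵖ N]
  [AddCommGroup W] [Module R W]

lemma contract_eq_map_contractLeft (f : LeftDual R W) (s : BTensor R (BTensor R M N) W) :
    contract f s = BTensor.map LinearMap.id (contractLeft f) (BTensor.assoc M N W s) := by
  induction s using BTensor.induction_on with
  | zero => simp
  | tmul s c =>
    induction s using BTensor.induction_on with
    | zero => simp
    | tmul m d => simp [BTensor.op_smul_tmul, contractLeft]
    | add s t hs ht => rw [BTensor.add_tmul]; simp only [map_add, hs, ht]
  | add s t hs ht => simp only [map_add, hs, ht]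

end LeftDual

section

variable {R : Type u} [Ring R] {V M N W : Type u} [AddCommGroup V] [Module Rᵐᵒᵖ V]
  [AddCommGroup M] [Module Rᵐᵒᵖ M]
  [AddCommGroup N] [Module R N] [Module Rᵐᵒᵖ N] [SMulCommClass R Rᵐᵒᵖ N]
  [AddCommGroup W] [Module R W]

/-- On a pure tensor m ⊗ y this is the dual basis expansion of y; unions of finite sets handle sums.
-/
lemma exists_finset_eq_sum_contractLeft (κ : V →ₗ[Rᵐᵒᵖ] LeftDual R W)
    (x : BTensor R M (BTensor R N W)) :
    ∃ S : Finset W, ∀ (n : ℕ) (v : Fin n → V) (u : Fin n → W), IsDualBasisOn κ S v u →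
      x = ∑ i, BTensor.map LinearMap.id (BTensor.tmulRight (u i))
        (BTensor.map LinearMap.id (LeftDual.contractLeft (κ (v i))) x) := by
  classical
  induction x using BTensor.induction_on with
  | zero => exact ⟨∅, fun n v u _ => by simp⟩
  | tmul m y =>
    obtain ⟨S, hS⟩ := exists_finset_eq_sum_contract κ y
    refine ⟨S, fun n v u H => ?_⟩
    conv_lhs => rw [hS n v u H, BTensor.tmul_sum]
    rfl
  | add s t hs ht =>
    obtain ⟨S, hS⟩ := hs
    obtain ⟨T, hT⟩ := ht
    refine ⟨S ∪ T, fun n v u H => ?_⟩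
    simp only [map_add, Finset.sum_add_distrib]
    rw [← hS n v u (H.mono Finset.subset_union_left),
      ← hT n v u (H.mono Finset.subset_union_right)]

/-- Under the `α`-condition the functionals of the pairing, applied to the last two factors,
separate the elements of `M ⊗_R (W ⊗_R W)`. -/
lemma HasLocalDualBases.eq_of_contract_contract_eq [Module Rᵐᵒᵖ W] [SMulCommClass R Rᵐᵒᵖ W]
    {κ : V →ₗ[Rᵐᵒᵖ] LeftDual R W} (H : HasLocalDualBases κ)
    {x y : BTensor R M (BTensor R W W)}
    (h : ∀ v v', LeftDual.contract (κ v')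
        (BTensor.map LinearMap.id (LeftDual.contractLeft (κ v)) x) =
      LeftDual.contract (κ v') (BTensor.map LinearMap.id (LeftDual.contractLeft (κ v)) y)) :
    x = y := by
  classical
  -- The α-condition for M removes the second functional; the expansion along the last factor then
  -- removes the first.
  have h' : ∀ v, BTensor.map LinearMap.id (LeftDual.contractLeft (κ v)) x =
      BTensor.map LinearMap.id (LeftDual.contractLeft (κ v)) y := fun v =>
    H.alphaCondition M (LinearMap.ext fun v' => h v v')
  obtain ⟨S, hS⟩ := exists_finset_eq_sum_contractLeft κ x
  obtain ⟨T, hT⟩ := exists_finset_eq_sum_contractLeft κ y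
  obtain ⟨n, v, u, hb⟩ := H (S ∪ T)
  rw [hS n v u (hb.mono Finset.subset_union_left),
    hT n v u (hb.mono Finset.subset_union_right)]
  simp only [h']

end

/-! ### Coactions and the counit. -/

namespace Comod

variable {R C : Type u} [Ring R] [AddCommGroup C] [Module R C] [Module Rᵐᵒᵖ C]
    [SMulCommClass R Rᵐᵒᵖ C] [Coring R C]

/-- The coaction intertwines the action of `f ∈ *C` on `M` and the translation on `M ⊗_R C`. -/
lemma ϱ_contract (M : Comod R C) (f : LeftDual R C) (m : M.carrier) :
    M.ϱ (LeftDual.contract f (M.ϱ m)) =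
      BTensor.map LinearMap.id (LeftDual.translate f) (M.ϱ m) := by
  rw [← LeftDual.contract_map, LeftDual.contract_eq_map_contractLeft, M.coassoc,
    BTensor.map_map]
  rfl

lemma translate_one_eq_id : LeftDual.translate (1 : LeftDual R C) = LinearMap.id :=
  LinearMap.ext LeftDual.translate_one

/-- Comodules with injective coaction are counital. -/
lemma contract_one (M : Comod R C) (m : M.carrier) :
    LeftDual.contract (1 : LeftDual R C) (M.ϱ m) = m := by
  apply M.counital
  rw [M.ϱ_contract, translate_one_eq_id, BTensor.map_id_id]

end Comod

/-! ### Comodules, rational modules and σ[C]. -/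

namespace MeasuringLeftPairing

variable {R A C : Type u} [Ring R] [Ring A] [Module R A] [Module Rᵐᵒᵖ A] [RRing R A]
  [AddCommGroup C] [Module R C] [Module Rᵐᵒᵖ C] [SMulCommClass R Rᵐᵒᵖ C] [Coring R C]
  (P : MeasuringLeftPairing R A C)

lemma unital_inducedModule (M : Comod R C) : RightMod.unital (P.inducedModule.obj M) := by
  rw [RightMod.unital_iff]
  intro (m : M.carrier)
  change LeftDual.contract (P.κ 1) (M.ϱ m) = m
  rw [map_one]
  exact M.contract_one m

lemma rational_inducedModule (M : Comod R C) : P.rational (P.inducedModule.obj M) :=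
  Set.eq_univ_of_forall fun m => ⟨M.ϱ m, rfl⟩

/-- The right `A`-module `M ⊗_R C`, with `(m ⊗ c) a = ∑ m ⊗ c₁ ⟨a, c₂⟩`. -/
def tensorModule (M : Type u) [AddCommGroup M] [Module Rᵐᵒᵖ M] : RightMod R A where
  carrier := BTensor R M C
  ρ := AddMonoidHom.mk'
    (fun t =>
      { toFun := fun a => BTensor.map LinearMap.id (LeftDual.translate (P.κ a)) t
        map_add' := fun a b => by
          induction t using BTensor.induction_on with
          | zero => simp
          | tmul m c =>
            simp [LeftDual.translate_apply, LeftDual.contract_add, BTensor.tmul_add]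
          | add s t hs ht =>
            rw [AddMonoidHom.map_add, hs, ht, AddMonoidHom.map_add, AddMonoidHom.map_add]
            abel
        map_smul' := fun r a => by
          induction t using BTensor.induction_on with
          | zero => simp
          | tmul m c =>
            have h : P.κ (r • a) = r • P.κ a := P.map_op_smul r.unop a
            have h' := LeftDual.contract_op_smul r.unop (P.κ a)
              ((Coring.comul (R := R) (C := C)).toLinearMap c)
            rw [h]
            exact congrArg (BTensor.tmul R m) h'
          | add s t hs ht => simp only [map_add, hs, ht, smul_add] })
    (fun s t => by ext a; exact map_add (BTensor.map _ _) s t)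
  ρ_smul t r a := by
    induction t using BTensor.induction_on with
    | zero => simp
    | tmul m c =>
      have h := LeftDual.contract_smul r (P.κ a)
        ((Coring.comul (R := R) (C := C)).toLinearMap c)
      rw [← P.map_smul] at h
      refine congrArg (BTensor.tmul R m) (Eq.trans ?_ h.symm)
      exact congrArg (LeftDual.contract (P.κ a))
        ((Coring.comul (R := R) (C := C)).map_op_smul' r c)
    | add s t hs ht => simp only [map_add, hs, ht, smul_add, LinearMap.add_apply]
  ρ_mul t a b := by
    change BTensor.map _ _ _ = BTensor.map _ _ (BTensor.map _ _ _)
    rw [BTensor.map_map, map_mul]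
    congr 2
    exact LinearMap.ext fun c => LeftDual.translate_mul _ _ c

lemma unital_tensorModule (M : Type u) [AddCommGroup M] [Module Rᵐᵒᵖ M] :
    RightMod.unital (P.tensorModule M) := by
  rw [RightMod.unital_iff]
  intro (t : BTensor R M C)
  change BTensor.map LinearMap.id (LeftDual.translate (P.κ 1)) t = t
  rw [map_one, Comod.translate_one_eq_id, BTensor.map_id_id]

/-- The map `C^(M) → M ⊗_R C`, `(c_m)_m ↦ ∑ m ⊗ c_m`. -/
def directSumToTensor (M : Type u) [AddCommGroup M] [Module Rᵐᵒᵖ M] :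
    P.coringModule.directSum M ⟶ P.tensorModule M where
  hom :=
    { toFun := Finsupp.liftAddHom (fun m : M => BTensor.mkHom (R := R) (N := C) m)
      map_add' := map_add _
      map_smul' := fun r x => by
        refine DFunLike.congr_fun (F := (M →₀ C) →+ BTensor R M C)
          (f := (Finsupp.liftAddHom fun m : M => BTensor.mkHom (R := R) (N := C) m).comp
            (DistribSMul.toAddMonoidHom (M →₀ C) r))
          (g := (DistribSMul.toAddMonoidHom (BTensor R M C) r).comp
            (Finsupp.liftAddHom fun m : M => BTensor.mkHom (R := R) (N := C) m))
          (Finsupp.addHom_ext fun m c => ?_) x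
        simp [BTensor.op_smul_tmul] }
  map_ρ x a := by
    refine DFunLike.congr_fun (F := (M →₀ C) →+ BTensor R M C)
      (f := (Finsupp.liftAddHom fun m : M => BTensor.mkHom (R := R) (N := C) m).comp
        (Finsupp.mapRange.addMonoidHom (LeftDual.translate (P.κ a)).toAddMonoidHom))
      (g := (BTensor.map LinearMap.id (LeftDual.translate (P.κ a))).comp
        (Finsupp.liftAddHom fun m : M => BTensor.mkHom (R := R) (N := C) m))
      (Finsupp.addHom_ext fun m c => ?_) x
    simp

lemma directSumToTensor_surjective (M : Type u) [AddCommGroup M] [Module Rᵐᵒᵖ M] :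
    Function.Surjective (P.directSumToTensor M).hom := by
  intro (t : BTensor R M C)
  induction t using BTensor.induction_on with
  | zero => exact ⟨0, map_zero _⟩
  | tmul m c =>
    refine ⟨(Finsupp.single m c : M →₀ C), ?_⟩
    exact Finsupp.liftAddHom_apply_single (fun m : M => BTensor.mkHom (R := R) (N := C) m) m c
  | add s t hs ht =>
    obtain ⟨x, rfl⟩ := hs
    obtain ⟨y, rfl⟩ := ht
    exact ⟨x + y, map_add _ _ _⟩

/-- The coaction as an `A`-linear map `M → M ⊗_R C`. -/
def coactionHom (M : Comod R C) : P.inducedModule.obj M ⟶ P.tensorModule M.carrier where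
  hom := M.ϱ
  map_ρ m a := M.ϱ_contract (P.κ a) m

/-- The injective coaction embeds M into M ⊗ C, a quotient of C^(M); no α-condition is needed. -/
lemma sigma_inducedModule (M : Comod R C) : P.sigma (P.inducedModule.obj M) :=
  ⟨P.unital_inducedModule M, P.tensorModule M.carrier, P.unital_tensorModule M.carrier,
    ⟨M.carrier, P.directSumToTensor M.carrier, P.directSumToTensor_surjective M.carrier⟩,
    P.coactionHom M, M.counital⟩

variable {P}

lemma rational.directSum {M : RightMod R A} (h : P.rational M) (Λ : Type u) :
    P.rational (M.directSum Λ) := by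
  refine Set.eq_univ_of_forall fun (x : Λ →₀ M.carrier) => ?_
  induction x using Finsupp.induction_linear with
  | zero => exact ⟨0, by rw [map_zero]; exact map_zero (M.directSum Λ).ρ⟩
  | add x y hx hy =>
    obtain ⟨s, hs⟩ := hx
    obtain ⟨t, ht⟩ := hy
    refine ⟨s + t, ?_⟩
    rw [map_add, ← hs, ← ht]
    exact map_add (M.directSum Λ).ρ _ _
  | single i m =>
    obtain ⟨t, ht⟩ := (Set.eq_univ_iff_forall.1 h) m
    refine ⟨BTensor.map (Finsupp.lsingle i : M.carrier →ₗ[Rᵐᵒᵖ] (Λ →₀ M.carrier))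
      LinearMap.id t, ?_⟩
    ext a
    refine Eq.trans ?_ (LeftDual.contract_map (P.κ a)
      (Finsupp.lsingle i : M.carrier →ₗ[Rᵐᵒᵖ] (Λ →₀ M.carrier)) t).symm
    refine Eq.trans ?_ (congrArg (Finsupp.single i) (DFunLike.congr_fun ht a))
    exact Finsupp.mapRange_single (hf := by simp)

lemma rational.of_surjective {M N : RightMod R A} (h : P.rational M) (f : M ⟶ N)
    (hf : Function.Surjective f.hom) : P.rational N := by
  refine Set.eq_univ_of_forall fun n => ?_
  obtain ⟨m, rfl⟩ := hf n
  obtain ⟨t, ht⟩ := (Set.eq_univ_iff_forall.1 h) m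
  refine ⟨BTensor.map f.hom LinearMap.id t, ?_⟩
  ext a
  rw [← f.map_ρ, ht, alphaMap_apply, alphaMap_apply, LeftDual.contract_map]

/-- The dual basis expansion of a witness for f(m) has coefficients f(m) vᵢ = f(m vᵢ), so it lifts
to M ⊗ C. Injectivity of f then makes the lift a witness for m. -/
lemma rational.of_injective (H : HasLocalDualBases P.toPairing) {M N : RightMod R A}
    (h : P.rational N) (f : M ⟶ N) (hf : Function.Injective f.hom) : P.rational M := by
  refine Set.eq_univ_of_forall fun m => ?_
  obtain ⟨t, ht⟩ := (Set.eq_univ_iff_forall.1 h) (f.hom m)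
  obtain ⟨n, v, u, hu⟩ := H.exists_eq_sum_contract t
  have hfm : BTensor.map f.hom LinearMap.id (∑ i, BTensor.tmul R (M.ρ m (v i)) (u i)) = t := by
    conv_rhs => rw [hu]
    rw [map_sum]
    refine Finset.sum_congr rfl fun i _ => ?_
    rw [BTensor.map_tmul, f.map_ρ, ht]
    rfl
  refine ⟨∑ i, BTensor.tmul R (M.ρ m (v i)) (u i), LinearMap.ext fun a => hf ?_⟩
  rw [f.map_ρ, ht, alphaMap_apply, alphaMap_apply, ← LeftDual.contract_map, hfm]

/-- The comodule structure on a unital rational module. -/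
lemma exists_comod_eq (H : HasLocalDualBases P.toPairing) (M : RightMod R A)
    (hu : RightMod.unital M) (hr : P.rational M) : ∃ N, P.inducedModule.obj N = M := by
  have hα := H.alphaCondition
  choose ϱ hϱ using Set.eq_univ_iff_forall.1 hr
  have hϱ' : ∀ m a, LeftDual.contract (P.κ a) (ϱ m) = M.ρ m a := fun m a => by
    rw [hϱ]; rfl
  -- The α-condition makes each chosen witness unique, which forces linearity of the choice.
  let ϱ' : M.carrier →ₗ[Rᵐᵒᵖ] BTensor R M.carrier C :=
    { toFun := ϱ
      map_add' := fun m n => hα _ (by rw [map_add, ← hϱ, ← hϱ, ← hϱ, map_add])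
      map_smul' := fun r m => hα _ (by
        ext a
        refine (hϱ' _ a).trans ?_
        refine (M.ρ_smul m r.unop a).trans ?_
        rw [← hϱ', P.map_smul, LeftDual.contract_smul]
        rfl) }
  let N : Comod R C :=
    { carrier := M.carrier
      ϱ := ϱ'
      -- Tested on a and b, coassociativity becomes (m a) b = m (a b).
      coassoc := fun m => H.eq_of_contract_contract_eq fun a b => by
        rw [← LeftDual.contract_eq_map_contractLeft, LeftDual.contract_map, BTensor.map_map]
        refine (hϱ' _ b).trans ?_
        refine Eq.trans ?_ (LeftDual.contract_map_translate (P.κ a) (P.κ b) (ϱ m)).symm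
        rw [← map_mul, hϱ', M.ρ_mul, ← hϱ' m a]
        rfl
      counital := fun m n hmn => by
        rw [← (RightMod.unital_iff M).1 hu m, ← (RightMod.unital_iff M).1 hu n, ← hϱ', ← hϱ']
        exact congrArg _ hmn }
  exact ⟨N, RightMod.eq_of_ρ_eq _ _ _ (AddMonoidHom.ext fun m => (hϱ m).symm)⟩

lemma inducedModule_faithful : P.inducedModule.Faithful where
  map_injective h := Comod.Hom.ext (congrArg RightMod.Hom.hom h)

/-- For an A-linear f, the two sides of the colinearity equation have equal contractions, so the
α-condition for the target identifies them. -/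
lemma inducedModule_full (H : AlphaCondition P.toPairing) : P.inducedModule.Full where
  map_surjective {M N} f := by
    refine ⟨⟨f.hom, fun m => H N.carrier ?_⟩, rfl⟩
    refine LinearMap.ext fun a => (f.map_ρ m a).symm.trans ?_
    exact (LeftDual.contract_map (P.κ a) f.hom (M.ϱ m)).symm

lemma inducedModule_obj_injective (H : AlphaCondition P.toPairing) :
    Function.Injective P.inducedModule.obj := by
  rintro ⟨M, ϱ, _, _⟩ ⟨N, ϱ', _, _⟩ h
  simp only [inducedModule, RightMod.mk.injEq] at h
  obtain ⟨rfl, h₁, h₂, h₃⟩ := h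
  obtain rfl := eq_of_heq h₁
  obtain rfl := eq_of_heq h₂
  have : ϱ = ϱ' := LinearMap.ext fun m =>
    H M (DFunLike.congr_fun (eq_of_heq h₃) m)
  subst this
  rfl

lemma ratFaithful_eq_ratUnital : P.ratFaithful = P.ratUnital := by
  rw [ratFaithful, ratUnital, RightMod.faithful_eq_unital]

lemma inducesIsoOnto_ratUnital (H : AlphaCondition P.toPairing) :
    InducesIsoOnto P.inducedModule P.ratUnital := by
  have := inducedModule_faithful (P := P)
  have := inducedModule_full H
  exact inducesIsoOnto_of _ _ (fun M => ⟨P.unital_inducedModule M, P.rational_inducedModule M⟩)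
    (inducedModule_obj_injective H) fun N hN => exists_comod_eq H.hasLocalDualBases N hN.1 hN.2

/-- Rationality spreads from C to direct sums, quotients and submodules; only the last step uses
dual bases. -/
lemma ratUnital_eq_sigma (H : AlphaCondition P.toPairing) : P.ratUnital = P.sigma := by
  ext M
  constructor
  · rintro ⟨hu, hr⟩
    obtain ⟨N, rfl⟩ := exists_comod_eq H.hasLocalDualBases M hu hr
    exact P.sigma_inducedModule N
  · rintro ⟨hu, Q, -, ⟨Λ, g, hg⟩, f, hf⟩
    exact ⟨hu, (((P.rational_inducedModule _).directSum Λ).of_surjective g hg).of_injective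
      H.hasLocalDualBases f hf⟩

/-- If `M^C` is isomorphic to `σ[C_A]`, then the finite subsets of `C` have dual bases: the
submodule of `C^(C)` generated by `∑_{c ∈ S} c` is a comodule, and its coaction yields one. -/
lemma hasLocalDualBases_of_inducesIsoOnto (h : InducesIsoOnto P.inducedModule P.sigma) :
    HasLocalDualBases P.toPairing := by
  classical
  intro S
  have hfull := h.full
  let K := P.coringModule
  -- The coordinate of x at c in S is c itself, so a single generator records all of S.
  let x : C →₀ C := ∑ c ∈ S, Finsupp.single c c
  have hx : ∀ c ∈ S, x c = c := fun c hc => by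
    simp [x, Finsupp.finsetSum_apply, Finsupp.single_apply, hc]
  let D : RightMod R A := K.directSum C
  have hK : RightMod.unital K := P.unital_inducedModule _
  obtain ⟨M, ⟨e⟩⟩ := h.exists_iso (RightMod.sigma_cyclic_directSum hK C x)
  obtain ⟨y, hy⟩ : ∃ y : M.carrier, e.hom.hom y =
      ⟨x, 1, (RightMod.unital_iff D).1 (hK.directSum C) x⟩ :=
    RightMod.hom_surjective_of_iso e _
  -- Fullness turns each A-linear coordinate projection into a colinear map to C, sending y to c for
  -- c in S.
  choose g hg using fun c : C =>
    P.inducedModule.map_surjective (X := M) (Y := Comod.regular R C)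
      (e.hom ≫ D.cyclicι x ≫ K.directSumProj C c)
  have hgy : ∀ c ∈ S, (g c).hom y = c := fun c hc => by
    have h₁ : (g c).hom y = (e.hom ≫ D.cyclicι x ≫ K.directSumProj C c).hom y :=
      DFunLike.congr_fun (congrArg RightMod.Hom.hom (hg c)) y
    have h₂ : (e.hom ≫ D.cyclicι x ≫ K.directSumProj C c).hom y = x c := by
      change (K.directSumProj C c).hom ((D.cyclicι x).hom (e.hom.hom y)) = x c
      rw [hy]; rfl
    exact h₁.trans (h₂.trans (hx c hc))
  -- As y generates M, the left components of its coaction are of the form y aᵢ, with aᵢ independent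
  -- of c.
  have hM : ∀ m : M.carrier, ∃ a, LeftDual.contract (P.κ a) (M.ϱ y) = m := fun m => by
    obtain ⟨a, ha⟩ := (e.hom.hom m).2
    refine ⟨a, RightMod.hom_injective_of_iso e ?_⟩
    refine (e.hom.map_ρ y a).trans (Subtype.ext ?_)
    rw [hy]
    exact ha
  obtain ⟨n, m, u, hu⟩ := BTensor.exists_eq_sum_tmul (M.ϱ y)
  choose a ha using fun i => hM (m i)
  refine ⟨n, a, u, fun c hc => ?_⟩
  have h₁ : ∀ i, (g c).hom (m i) = LeftDual.translate (P.κ (a i)) c := fun i => by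
    rw [← ha i, ← LeftDual.contract_map, ← (g c).map_ϱ, hgy c hc]
    rfl
  have h₂ : (Coring.comul (R := R) (C := C)).toLinearMap c =
      ∑ i, BTensor.tmul R (LeftDual.translate (P.κ (a i)) c) (u i) := by
    have h₃ := (g c).map_ϱ y
    rw [hgy c hc, hu, map_sum] at h₃
    refine Eq.trans h₃ (Finset.sum_congr rfl fun i _ => ?_)
    rw [← h₁]
    rfl
  -- Applying ε to the left factor of Δ(c) = ∑ c aᵢ ⊗ uᵢ leaves c = ∑ ⟨aᵢ, c⟩ uᵢ, because ε(c aᵢ) =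
  -- ⟨aᵢ, c⟩.
  have h₄ := Coring.counit_left (R := R) c
  rw [h₂, map_sum, map_sum] at h₄
  refine Eq.trans (Finset.sum_congr rfl fun i _ => ?_) h₄
  simp only [BTensor.map_tmul, BTensor.lid_tmul, BilinHom.right_apply,
    LeftDual.counit_translate]
  rfl

end MeasuringLeftPairing

end Comodules

end Corings

end

/-! ### The equivalences and the resulting isomorphisms. -/

theorem mainTheorem1 {R A C : Type u} [Ring R]
    [AddCommGroup C] [Module R C] [Module Rᵐᵒᵖ C] [SMulCommClass R Rᵐᵒᵖ C] [Coring R C]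
    [Ring A] [Module R A] [Module Rᵐᵒᵖ A] [RRing R A] (P : MeasuringLeftPairing R A C) :
    List.TFAE
      [LocallyProjective R C ∧ DensePairing P.toPairing,
       ModuleAlphaCondition R C ∧ DensePairing P.toPairing,
       AlphaCondition P.toPairing,
       InducesIsoOnto (MeasuringLeftPairing.dual R C).inducedModule
          (MeasuringLeftPairing.dual R C).sigma ∧
        InducesIsoOnto P.inducedModule P.sigma] ∧
    (AlphaCondition P.toPairing →
      (InducesIsoOnto P.inducedModule P.ratFaithful ∧
        P.ratFaithful = P.ratUnital ∧ P.ratUnital = P.sigma) ∧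
      (InducesIsoOnto (MeasuringLeftPairing.dual R C).inducedModule
          (MeasuringLeftPairing.dual R C).ratFaithful ∧
        (MeasuringLeftPairing.dual R C).ratFaithful = (MeasuringLeftPairing.dual R C).ratUnital ∧
        (MeasuringLeftPairing.dual R C).ratUnital = (MeasuringLeftPairing.dual R C).sigma)) := by
  -- The images κ(aᵢ) of a dual basis from A form one from the dual ring.
  have alphaDual : AlphaCondition P.toPairing →
      AlphaCondition (MeasuringLeftPairing.dual R C).toPairing := fun h =>
    ((hasLocalDualBases_iff_dense _).1 h.hasLocalDualBases).1.alphaCondition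
  constructor
  · tfae_have 1 ↔ 2 := by
      rw [locallyProjective_iff_hasLocalDualBases, ModuleAlphaCondition,
        alphaCondition_iff_hasLocalDualBases]
    tfae_have 2 ↔ 3 := by
      rw [ModuleAlphaCondition, alphaCondition_iff_hasLocalDualBases,
        alphaCondition_iff_hasLocalDualBases, hasLocalDualBases_iff_dense P.toPairing]
    tfae_have 3 → 4 := fun h =>
      ⟨MeasuringLeftPairing.ratUnital_eq_sigma (alphaDual h) ▸
        MeasuringLeftPairing.inducesIsoOnto_ratUnital (alphaDual h),
        MeasuringLeftPairing.ratUnital_eq_sigma h ▸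
          MeasuringLeftPairing.inducesIsoOnto_ratUnital h⟩
    -- Only the isomorphism onto σ[C_A] is needed here.
    tfae_have 4 → 3 := fun h =>
      (MeasuringLeftPairing.hasLocalDualBases_of_inducesIsoOnto h.2).alphaCondition
    tfae_finish
  · intro h
    rw [MeasuringLeftPairing.ratFaithful_eq_ratUnital,
      MeasuringLeftPairing.ratFaithful_eq_ratUnital]
    exact ⟨⟨MeasuringLeftPairing.inducesIsoOnto_ratUnital h, rfl,
      MeasuringLeftPairing.ratUnital_eq_sigma h⟩,
      MeasuringLeftPairing.inducesIsoOnto_ratUnital (alphaDual h), rfl,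
      MeasuringLeftPairing.ratUnital_eq_sigma (alphaDual h)⟩
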